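/- Fix integers $r\ge 2$ and $m\ge 1$, and let $\Sigma=\{0,\dots,r-1\}^m$ be the alphabet of digit vectors. For a word $\sigma=b_1\cdots b_n\in\Sigma^*$ put $\rho(\sigma)=\sum_{i=1}^n r^{i-1}b_i\in\mathbb N^m$ (least significant digit first; $\rho(\varepsilon)=0$), and for $L\subseteq\Sigma^*$ put $\rho(L)=\{\rho(\sigma):\sigma\in L\}\subseteq\mathbb R^m$. A set $C\subseteq\mathbb R^m$ is polyhedral if it is a finite intersection of closed half-spaces $\{x:\langle\alpha,x\rangle+c\ge 0\}$ ($\alpha\in\mathbb R^m$, $c\in\mathbb R$). A finite set of rays $R\subseteq\mathbb R^m\times\mathbb R_{\ge 0}$ represents $P\subseteq\mathbb R^m$ if $P=\{x:(x,1)\in C(R)\}$, where $C(R)=\{\sum_{p\in R}t_p\,p : t_p\ge 0\}$. Theorem. (1) For every regular language $L\subseteq\Sigma^*$ (i.e. accepted by a finite automaton), the closure $\mathrm{cl}(\mathrm{conv}(\rho(L)))$ of the convex hull of $\rho(L)$ is polyhedral. (2) There is an algorithm which, given any regular expression $e$ over $\Sigma$, computes in exponential time a finite list of rays in $\mathbb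 Z^m\times\mathbb N$ that represents $\mathrm{cl}(\mathrm{conv}(\rho(L(e))))$, where $L(e)$ is the language defined by $e$. More precisely, there are a deterministic multi-stack Turing machine and a polynomial $p$, which may depend on $r$ and $m$, such that on every regular expression $e$, written in postfix notation as a word of length $n$, the machine halts after at most $2^{p(n)}$ steps and outputs such a list, its integers being written in base $r$. -/

import Mathlib

/-- The alphabet of digit vectors `{0, …, r - 1}^m`. -/
abbrev DigitVector (r m : ℕ) : Type := Fin m → Fin r

/-- The vector `ρ(b₁ … bₙ) = ∑ᵢ r ^ (i - 1) • bᵢ` represented by a word of digit vectors, least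
significant digit first (`Nat.ofDigits r` evaluates a least-significant-first digit list). -/
def rho {r m : ℕ} (w : List (DigitVector r m)) : Fin m → ℕ :=
  fun j => Nat.ofDigits r (w.map fun b => (b j : ℕ))

/-- The set `ρ(L)` of integer vectors represented by a language `L`, as a subset of `ℝ^m`.
(The topology of `Fin m → ℝ` is the usual one.) -/
def representedSet {r m : ℕ} (L : Language (DigitVector r m)) : Set (Fin m → ℝ) :=
  {x | ∃ w ∈ L, x = fun j => (rho w j : ℝ)}

/-- A closed half-space `{x | ⟨α, x⟩ + c ≥ 0}`; `α = 0` is allowed. -/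
def IsClosedHalfSpace {m : ℕ} (H : Set (Fin m → ℝ)) : Prop :=
  ∃ (α : Fin m → ℝ) (c : ℝ), H = {x | α ⬝ᵥ x + c ≥ 0}

/-- A polyhedral convex set: a finite intersection of closed half-spaces. -/
def IsPolyhedralConvex {m : ℕ} (C : Set (Fin m → ℝ)) : Prop :=
  ∃ 𝓗 : Set (Set (Fin m → ℝ)), 𝓗.Finite ∧ (∀ H ∈ 𝓗, IsClosedHalfSpace H) ∧ C = ⋂₀ 𝓗

/-- The cone `C(R)` of all nonnegative combinations of a finite set `R` of rays. -/
def rayCone {m : ℕ} (R : Finset ((Fin m → ℝ) × ℝ)) : Set ((Fin m → ℝ) × ℝ) :=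
  {y | ∃ t : (Fin m → ℝ) × ℝ → ℝ, (∀ p ∈ R, 0 ≤ t p) ∧ y = ∑ p ∈ R, t p • p}

/-- `P` is represented by the finite set of rays `R ⊆ ℝ^m × ℝ₊`, that is,
`P = P(R) = {x | (x, 1) ∈ C(R)}`. -/
def IsRepresentedByRays {m : ℕ} (P : Set (Fin m → ℝ)) (R : Finset ((Fin m → ℝ) × ℝ)) : Prop :=
  (∀ p ∈ R, 0 ≤ p.2) ∧ P = {x | (x, 1) ∈ rayCone R}

/-- A ray `(α, c)` with integer entries and `c ≥ 0`. -/
abbrev IntRay (m : ℕ) : Type := (Fin m → ℤ) × ℕ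

/-- The finite set of rays in `ℝ^m × ℝ₊` listed by a list of integer rays. -/
noncomputable def realRays {m : ℕ} (l : List (IntRay m)) : Finset ((Fin m → ℝ) × ℝ) :=
  (l.map fun p => ((fun j => (p.1 j : ℝ)), (p.2 : ℝ))).toFinset

/-- The (finite, if `A` is) alphabet in which regular expressions over `A` are written. -/
inductive RegexToken (A : Type) : Type
  | zero
  | epsilon
  | char (a : A)
  | plus
  | comp
  | star
  deriving DecidableEq, Fintype

/-- Regular expressions written as words, in postfix notation. -/
def encodeRegex {A : Type} : RegularExpression A → List (RegexToken A)
  | .zero => [.zero]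
  | .epsilon => [.epsilon]
  | .char a => [.char a]
  | .plus e f => encodeRegex e ++ encodeRegex f ++ [.plus]
  | .comp e f => encodeRegex e ++ encodeRegex f ++ [.comp]
  | .star e => encodeRegex e ++ [.star]

/-- One step of a stack parser for postfix notation. -/
def parseStep {A : Type} :
    List (RegularExpression A) → RegexToken A → List (RegularExpression A)
  | s, .zero => .zero :: s
  | s, .epsilon => .epsilon :: s
  | s, .char a => .char a :: s
  | f :: e :: s, .plus => .plus e f :: s
  | f :: e :: s, .comp => .comp e f :: s
  | e :: s, .star => .star e :: s
  | s, _ => s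

theorem foldl_parseStep_encodeRegex {A : Type} (e : RegularExpression A)
    (s : List (RegularExpression A)) : (encodeRegex e).foldl parseStep s = e :: s := by
  induction e generalizing s with
  | zero => rfl
  | epsilon => rfl
  | char a => rfl
  | plus e f he hf => simp only [encodeRegex, List.foldl_append, he, hf]; rfl
  | comp e f he hf => simp only [encodeRegex, List.foldl_append, he, hf]; rfl
  | star e he => simp only [encodeRegex, List.foldl_append, he]; rfl

/-- The notation for regular expressions is unambiguous. -/
theorem encodeRegex_injective {A : Type} :
    Function.Injective (encodeRegex : RegularExpression A → List (RegexToken A)) := by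
  intro e f h
  have := congrArg (List.foldl parseStep []) h
  simpa [foldl_parseStep_encodeRegex] using this

/-- The finite alphabet in which lists of integer rays are written: base-`r` digits, a minus sign
and an end-of-number mark. -/
inductive RayToken (r : ℕ) : Type
  | digit (d : Fin r)
  | minus
  | stop_mark
  deriving DecidableEq, Fintype

/-- The base-`r` digits of `n`, least significant first, without superfluous zeros. -/
def encodeDigits {r : ℕ} (hr : 2 ≤ r) (n : ℕ) : List (RayToken r) :=
  (Nat.digits r n).pmap (fun d hd => .digit ⟨d, hd⟩) fun _ hd => Nat.digits_lt_base hr hd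

/-- An integer in sign-and-magnitude base-`r` notation, followed by the end-of-number mark. -/
def encodeInt {r : ℕ} (hr : 2 ≤ r) (z : ℤ) : List (RayToken r) :=
  (if z < 0 then [.minus] else []) ++ encodeDigits hr z.natAbs ++ [.stop_mark]

/-- A ray `(α, c)`, written as the sequence of the integers `α₁, …, αₘ, c`. -/
def encodeRay {r m : ℕ} (hr : 2 ≤ r) (p : IntRay m) : List (RayToken r) :=
  (List.ofFn fun j => encodeInt hr (p.1 j)).flatten ++ encodeInt hr p.2

/-- A list of rays, written one ray after the other. -/
def encodeRays {r m : ℕ} (hr : 2 ≤ r) (l : List (IntRay m)) : List (RayToken r) :=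
  l.flatMap (encodeRay hr)

theorem encodeDigits_append_inj {r : ℕ} (hr : 2 ≤ r) {n n' : ℕ} {s s' : List (RayToken r)}
    (h : encodeDigits hr n ++ .stop_mark :: s = encodeDigits hr n' ++ .stop_mark :: s') :
    n = n' ∧ s = s' := by
  have key : ∀ (l l' : List ℕ) (hl : ∀ d ∈ l, d < r) (hl' : ∀ d ∈ l', d < r),
      l.pmap (fun d hd => RayToken.digit ⟨d, hd⟩) hl ++ .stop_mark :: s =
        l'.pmap (fun d hd => RayToken.digit ⟨d, hd⟩) hl' ++ .stop_mark :: s' →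
      l = l' ∧ s = s' := by
    intro l
    induction l with
    | nil => intro l' hl hl' h; cases l' <;> simp_all
    | cons a l ih =>
      intro l' hl hl' h
      cases l' with
      | nil => simp at h
      | cons b l' =>
        simp only [List.pmap_cons, List.cons_append, List.cons.injEq, RayToken.digit.injEq,
          Fin.mk.injEq] at h
        obtain ⟨h1, h2⟩ := ih l' _ _ h.2
        exact ⟨by rw [h.1, h1], h2⟩
  obtain ⟨h1, h2⟩ := key _ _ _ _ h
  exact ⟨Nat.digits_inj_iff.1 h1, h2⟩

theorem encodeInt_append_inj {r : ℕ} (hr : 2 ≤ r) {z z' : ℤ} {s s' : List (RayToken r)}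
    (h : encodeInt hr z ++ s = encodeInt hr z' ++ s') : z = z' ∧ s = s' := by
  have hne : ∀ (n : ℕ) (t t' : List (RayToken r)),
      RayToken.minus :: t ≠ encodeDigits hr n ++ .stop_mark :: t' := by
    intro n t t'
    unfold encodeDigits
    generalize_proofs hl
    revert hl
    cases Nat.digits r n <;> simp
  unfold encodeInt at h
  split_ifs at h with h1 h2 h2 <;> simp only [List.append_assoc, List.cons_append,
    List.nil_append, List.cons.injEq, true_and] at h
  · obtain ⟨h3, h4⟩ := encodeDigits_append_inj hr h
    exact ⟨by omega, h4⟩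
  · exact absurd h (hne _ _ _)
  · exact absurd h.symm (hne _ _ _)
  · obtain ⟨h3, h4⟩ := encodeDigits_append_inj hr h
    exact ⟨by omega, h4⟩

theorem encodeRay_append_inj {r m : ℕ} (hr : 2 ≤ r) {p p' : IntRay m} {s s' : List (RayToken r)}
    (h : encodeRay hr p ++ s = encodeRay hr p' ++ s') : p = p' ∧ s = s' := by
  have key : ∀ (k : ℕ) (a a' : Fin k → ℤ) (t t' : List (RayToken r)),
      (List.ofFn fun j => encodeInt hr (a j)).flatten ++ t =
        (List.ofFn fun j => encodeInt hr (a' j)).flatten ++ t' → a = a' ∧ t = t' := by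
    intro k
    induction k with
    | zero => intro a a' t t' h; exact ⟨Subsingleton.elim _ _, by simpa using h⟩
    | succ k ih =>
      intro a a' t t' h
      simp only [List.ofFn_succ, List.flatten_cons, List.append_assoc] at h
      obtain ⟨h1, h2⟩ := encodeInt_append_inj hr h
      obtain ⟨h3, h4⟩ := ih _ _ _ _ h2
      refine ⟨funext fun j => ?_, h4⟩
      refine Fin.cases h1 (fun j => congrFun h3 j) j
  simp only [encodeRay, List.append_assoc] at h
  obtain ⟨h1, h2⟩ := key _ _ _ _ _ h
  obtain ⟨h3, h4⟩ := encodeInt_append_inj hr h2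
  exact ⟨Prod.ext h1 (by exact_mod_cast h3), h4⟩

/-- The notation for lists of rays is unambiguous. -/
theorem encodeRays_injective {r m : ℕ} (hr : 2 ≤ r) :
    Function.Injective (encodeRays hr : List (IntRay m) → List (RayToken r)) := by
  have hne : ∀ p : IntRay m, encodeRay hr p ≠ [] := by
    intro p h
    simp [encodeRay, encodeInt] at h
  intro l
  induction l with
  | nil =>
    intro l' h
    cases l' with
    | nil => rfl
    | cons p' l' => simp [encodeRays, hne] at h
  | cons p l ih =>
    intro l' h
    cases l' with
    | nil => simp [encodeRays, hne] at h
    | cons p' l' =>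
      simp only [encodeRays, List.flatMap_cons] at h
      obtain ⟨h1, h2⟩ := encodeRay_append_inj hr h
      rw [h1, ih h2]

/-- `f` is computable in exponential time: some deterministic multi-stack Turing machine with
finitely many states, stacks and stack symbols, started on the word `ea a`, halts with output
`eb (f a)` after at most `2 ^ p(n)` steps, where `n` is the length of `ea a` and `p` is a fixed
polynomial. -/
def ComputableInExpTime {α β αΓ βΓ : Type} (ea : α → List αΓ) (eb : β → List βΓ)
    (f : α → β) : Prop :=
  ∃ M : Turing.TM2ComputableInTime ea eb f, (∀ k, Finite (M.tm.Γ k)) ∧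
    ∃ p : Polynomial ℕ, ∀ n, M.time n ≤ 2 ^ p.eval n

/-! Inserting a factor `v` into a word changes its value by `ρ(uvz) = ρ(uz) + r^|u| (ρ(vz) - ρ(z))`,
so up to a positive scalar the change does not depend on `u` (`wordRay_insert`). If all words `u v^k
z` lie in `L`, then `ρ(L)` has arbitrarily distant points in the direction `ρ(vz) - ρ(z)`, which is
therefore a recession direction of the closed convex hull (`realRho_pump`,
`recession_of_unbounded`). So if deleting pumpable factors reduces every word of `L` to one of
finitely many words `w`, and only finitely many pairs `(vz, z)` occur, then the rays `(ρ(w), 1)` and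
`(ρ(vz) - ρ(z), 0)` represent the closed hull (`IsPumpBase.closure_convexHull_eq`). They represent a
closed set because finitely generated cones are polyhedral, by Fourier–Motzkin elimination.

For an automaton, the pigeonhole principle applied to the end of a long word provides the factors
(`DFA.isPumpBase`); this gives (1). For a regular expression, words and pairs are defined by
recursion (`RegularExpression.isPumpBase`).

Each of them is determined by one binary choice per token, plus one choice between "word" and
"pair". A machine runs a binary counter through all choices. For each value it scans the expression
once from the root, keeping a stack of modes for the pending subexpressions, and writes one ray,
namely zero if the choices are inconsistent. Such scans are sound and complete (`exists_scanEffect`,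
`Generates.exists_scanEffect`). A round takes linear time, and the number of rounds is exponential.
-/

open Filter Topology

/-! ### Polyhedral cones and Fourier–Motzkin elimination. -/

/-- A polyhedral cone: the solution set of finitely many homogeneous linear inequalities. -/
def IsPolyhedralCone {V : Type*} [AddCommGroup V] [Module ℝ V] (C : Set V) : Prop :=
  ∃ F : Set (Module.Dual ℝ V), F.Finite ∧ C = {x | ∀ f ∈ F, 0 ≤ f x}

/-- Fourier–Motzkin elimination: adding a ray to a polyhedral cone gives a polyhedral cone. -/
theorem IsPolyhedralCone.add_ray {V : Type*} [AddCommGroup V] [Module ℝ V] {C : Set V}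
    (hC : IsPolyhedralCone C) (v : V) :
    IsPolyhedralCone {x | ∃ t : ℝ, 0 ≤ t ∧ x - t • v ∈ C} := by
  obtain ⟨F, hF, rfl⟩ := hC
  -- Functionals with `f v > 0` bound `t` above by `f x / f v`, those with `g v < 0` bound it below
  -- by `g x / g v`. The combinations vanish at `v` and say that each lower bound is at most each
  -- upper bound; the retained `f` say the same for the lower bound `0`.
  refine ⟨{f ∈ F | 0 ≤ f v} ∪
    Set.image2 (fun f g => f v • g - g v • f) {f ∈ F | 0 < f v} {g ∈ F | g v < 0},
    (hF.subset (Set.sep_subset _ _)).union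
      ((hF.subset (Set.sep_subset _ _)).image2 _ (hF.subset (Set.sep_subset _ _))), ?_⟩
  ext x
  simp only [Set.mem_ofPred_eq, Set.mem_union, Set.mem_image2, map_sub, map_smul, smul_eq_mul]
  constructor
  · rintro ⟨t, ht, hx⟩ h (⟨hf, hv⟩ | ⟨f, ⟨hf, hfv⟩, g, ⟨hg, hgv⟩, rfl⟩)
    · nlinarith [hx h hf]
    · simp only [LinearMap.sub_apply, LinearMap.smul_apply, smul_eq_mul]
      nlinarith [hx f hf, hx g hg]
  · intro h
    have hlow : ∀ g ∈ F, g v < 0 → ∀ f ∈ F, 0 < f v → g x / g v ≤ f x / f v := by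
      intro g hg hgv f hf hfv
      have := h _ (Or.inr ⟨f, ⟨hf, hfv⟩, g, ⟨hg, hgv⟩, rfl⟩)
      simp only [LinearMap.sub_apply, LinearMap.smul_apply, smul_eq_mul] at this
      rw [le_div_iff₀ hfv, div_mul_eq_mul_div, div_le_iff_of_neg hgv]
      linarith
    -- All lower bounds for `t`; the greatest of them is an admissible value.
    set S : Set ℝ := insert 0 ((fun g : Module.Dual ℝ V => g x / g v) '' {g ∈ F | g v < 0})
      with hS
    have hfin : S.Finite := ((hF.subset (Set.sep_subset _ _)).image _).insert 0
    obtain ⟨t, htS, ht⟩ := hfin.exists_maximalFor id S ⟨0, Set.mem_insert _ _⟩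
    have hmax : ∀ s ∈ S, s ≤ t := fun s hs => (le_total s t).elim id fun h' => ht hs h'
    refine ⟨t, hmax 0 (Set.mem_insert _ _), fun f hf => ?_⟩
    rcases lt_trichotomy (f v) 0 with hv | hv | hv
    · have := hmax _ (Set.mem_insert_of_mem _ ⟨f, ⟨hf, hv⟩, rfl⟩)
      rw [div_le_iff_of_neg hv] at this
      linarith
    · simpa [hv] using h f (Or.inl ⟨hf, hv.ge⟩)
    · have : t ≤ f x / f v := by
        rcases htS with rfl | ⟨g, ⟨hg, hgv⟩, rfl⟩
        · exact div_nonneg (h f (Or.inl ⟨hf, hv.le⟩)) hv.le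
        · exact hlow g hg hgv f hf hv
      rw [le_div_iff₀ hv] at this
      linarith

theorem isPolyhedralCone_zero {V : Type*} [AddCommGroup V] [Module ℝ V]
    [FiniteDimensional ℝ V] : IsPolyhedralCone ({0} : Set V) := by
  let b := Module.finBasis ℝ V
  refine ⟨Set.range b.coord ∪ Set.range fun i => -b.coord i,
    (Set.finite_range _).union (Set.finite_range _), ?_⟩
  ext x
  simp only [Set.mem_singleton_iff, Set.mem_union, Set.mem_range, Set.mem_ofPred_eq]
  constructor
  · rintro rfl f -
    simp
  · intro h
    refine b.ext_elem fun i => ?_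
    have h1 := h _ (Or.inl ⟨i, rfl⟩)
    have h2 := h _ (Or.inr ⟨i, rfl⟩)
    simp only [Module.Basis.coord_apply, LinearMap.neg_apply] at h1 h2
    simp only [map_zero, Finsupp.coe_zero, Pi.zero_apply]
    linarith

/-! ### Finitely generated cones, polyhedra and recession directions. -/

section RayCone

variable {m : ℕ}

theorem rayCone_empty : rayCone (∅ : Finset ((Fin m → ℝ) × ℝ)) = {0} := by
  ext x
  simp [rayCone]

/-- This puts the cone into the form treated by `IsPolyhedralCone.add_ray`, so that Minkowski–Weyl
becomes an induction on the number of rays. -/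
theorem rayCone_insert (R : Finset ((Fin m → ℝ) × ℝ)) {p : (Fin m → ℝ) × ℝ} (hp : p ∉ R) :
    rayCone (insert p R) = {x | ∃ t : ℝ, 0 ≤ t ∧ x - t • p ∈ rayCone R} := by
  ext x
  constructor
  · rintro ⟨t, ht, rfl⟩
    refine ⟨t p, ht p (Finset.mem_insert_self _ _), t,
      fun q hq => ht q (Finset.mem_insert_of_mem hq), ?_⟩
    rw [Finset.sum_insert hp, add_sub_cancel_left]
  · rintro ⟨s, hs, t, ht, hx⟩
    refine ⟨Function.update t p s, fun q hq => ?_, ?_⟩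
    · rcases Finset.mem_insert.1 hq with rfl | hq
      · simpa using hs
      · rw [Function.update_of_ne (ne_of_mem_of_not_mem hq hp)]
        exact ht q hq
    · rw [Finset.sum_insert hp, Function.update_self, eq_add_of_sub_eq' hx]
      congr 1
      exact Finset.sum_congr rfl fun q hq => by
        rw [Function.update_of_ne (ne_of_mem_of_not_mem hq hp)]

/-- The Minkowski–Weyl theorem: finitely generated cones are polyhedral. -/
theorem isPolyhedralCone_rayCone (R : Finset ((Fin m → ℝ) × ℝ)) :
    IsPolyhedralCone (rayCone R) := by
  classical
  induction R using Finset.induction_on with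
  | empty => rw [rayCone_empty]; exact isPolyhedralCone_zero
  | insert p R hp ih => rw [rayCone_insert R hp]; exact ih.add_ray p

/-- A linear functional on `ℝ^m × ℝ` becomes affine at height 1, its value at `(0, 1)` being the
constant term. -/
theorem IsPolyhedralConvex.of_cone {C : Set ((Fin m → ℝ) × ℝ)} (hC : IsPolyhedralCone C) :
    IsPolyhedralConvex {x | (x, 1) ∈ C} := by
  obtain ⟨F, hF, rfl⟩ := hC
  refine ⟨(fun f => {x | 0 ≤ f (x, 1)}) '' F, hF.image _, ?_, ?_⟩
  · rintro _ ⟨f, -, rfl⟩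
    refine ⟨fun j => f (Pi.single j 1, 0), f (0, 1), ?_⟩
    ext x
    have : f (x, 1) = (fun j => f (Pi.single j 1, 0)) ⬝ᵥ x + f (0, 1) := by
      have hx : ((x, 1) : (Fin m → ℝ) × ℝ) =
          ∑ j, x j • ((Pi.single j 1, 0) : (Fin m → ℝ) × ℝ) + (0, 1) := by
        refine Prod.ext ?_ ?_
        · simpa [Prod.fst_sum] using pi_eq_sum_univ' x
        · simp [Prod.snd_sum]
      rw [hx, map_add, map_sum]
      simp only [map_smul, smul_eq_mul, dotProduct, mul_comm]
    simp [this]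
  · ext x
    simp

theorem IsPolyhedralConvex.isClosed {C : Set (Fin m → ℝ)} (hC : IsPolyhedralConvex C) :
    IsClosed C := by
  obtain ⟨H, -, hH, rfl⟩ := hC
  refine isClosed_sInter fun h hh => ?_
  obtain ⟨α, c, rfl⟩ := hH h hh
  exact isClosed_le continuous_const (by unfold dotProduct; fun_prop)

theorem IsPolyhedralConvex.convex {C : Set (Fin m → ℝ)} (hC : IsPolyhedralConvex C) :
    Convex ℝ C := by
  obtain ⟨H, -, hH, rfl⟩ := hC
  refine convex_sInter fun h hh => ?_
  obtain ⟨α, c, rfl⟩ := hH h hh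
  intro x hx y hy a b ha hb hab
  simp only [Set.mem_ofPred_eq, dotProduct_add, dotProduct_smul, smul_eq_mul] at *
  have : c = a * c + b * c := by rw [← add_mul, hab, one_mul]
  nlinarith [mul_nonneg ha hx, mul_nonneg hb hy]

theorem mem_rayCone_of_mem {R : Finset ((Fin m → ℝ) × ℝ)} {p : (Fin m → ℝ) × ℝ} (hp : p ∈ R) :
    p ∈ rayCone R := by
  classical
  refine ⟨Pi.single p 1, fun q _ => ?_, ?_⟩
  · by_cases h : q = p
    · subst h; simp
    · simp [h]
  · rw [Finset.sum_eq_single_of_mem p hp fun q _ hq => by simp [hq]]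
    simp

theorem add_mem_rayCone {R : Finset ((Fin m → ℝ) × ℝ)} {x y : (Fin m → ℝ) × ℝ}
    (hx : x ∈ rayCone R) (hy : y ∈ rayCone R) : x + y ∈ rayCone R := by
  obtain ⟨s, hs, rfl⟩ := hx
  obtain ⟨t, ht, rfl⟩ := hy
  exact ⟨s + t, fun p hp => add_nonneg (hs p hp) (ht p hp), by
    simp [add_smul, Finset.sum_add_distrib]⟩

theorem smul_mem_rayCone {R : Finset ((Fin m → ℝ) × ℝ)} {x : (Fin m → ℝ) × ℝ}
    (hx : x ∈ rayCone R) {c : ℝ} (hc : 0 ≤ c) : c • x ∈ rayCone R := by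
  obtain ⟨s, hs, rfl⟩ := hx
  exact ⟨fun p => c * s p, fun p hp => mul_nonneg hc (hs p hp), by
    simp [Finset.smul_sum, mul_smul]⟩

/-- A closed convex set contains all points represented by rays that stand for points or
recession directions of the set. -/
theorem mem_of_mem_rayCone {C : Set (Fin m → ℝ)} (hC : Convex ℝ C)
    {R : Finset ((Fin m → ℝ) × ℝ)}
    (hR : ∀ p ∈ R, (p.2 = 1 ∧ p.1 ∈ C) ∨
      (p.2 = 0 ∧ ∀ x ∈ C, ∀ t : ℝ, 0 ≤ t → x + t • p.1 ∈ C))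
    {x : Fin m → ℝ} (hx : (x, 1) ∈ rayCone R) : x ∈ C := by
  classical
  obtain ⟨t, ht, hx⟩ := hx
  have h1 : x = ∑ p ∈ R, t p • p.1 := by simpa [Prod.fst_sum] using congrArg Prod.fst hx
  have h2 : 1 = ∑ p ∈ R, t p * p.2 := by simpa [Prod.snd_sum] using congrArg Prod.snd hx
  -- Separate points (height 1) from directions (height 0). The last coordinate then says that the
  -- coefficients of the points sum to 1.
  rw [← Finset.sum_filter_add_sum_filter_not R (fun p => p.2 = 1)] at h1 h2
  have hrec : ∀ p ∈ R.filter (fun p => ¬ p.2 = 1),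
      p.2 = 0 ∧ ∀ x ∈ C, ∀ t : ℝ, 0 ≤ t → x + t • p.1 ∈ C := by
    intro p hp
    rw [Finset.mem_filter] at hp
    exact (hR p hp.1).resolve_left fun h => hp.2 h.1
  rw [Finset.sum_congr (g := fun p => t p) rfl
      (fun p hp => by rw [(Finset.mem_filter.1 hp).2, mul_one]),
    Finset.sum_congr (s₁ := R.filter fun p => ¬ p.2 = 1) (g := fun _ => (0 : ℝ)) rfl
      (fun p hp => by rw [(hrec p hp).1, mul_zero]), Finset.sum_const_zero, add_zero] at h2
  have h3 : ∑ p ∈ R.filter (fun p => p.2 = 1), t p • p.1 ∈ C := by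
    refine hC.sum_mem (fun p hp => ht p (Finset.mem_filter.1 hp).1) h2.symm fun p hp => ?_
    rw [Finset.mem_filter] at hp
    rcases hR p hp.1 with h | h
    · exact h.2
    · exact absurd (hp.2.symm.trans h.1) one_ne_zero
  have h4 : ∀ x ∈ C, x + ∑ p ∈ R.filter (fun p => ¬ p.2 = 1), t p • p.1 ∈ C := by
    refine Finset.sum_induction _ (fun v => ∀ x ∈ C, x + v ∈ C) ?_ ?_ ?_
    · intro v w hv hw x hx
      rw [← add_assoc]
      exact hw _ (hv x hx)
    · intro x hx
      rwa [add_zero]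
    · intro p hp x hx
      exact (hrec p hp).2 x hx _ (ht p (Finset.mem_filter.1 hp).1)
  rw [h1]
  exact h4 _ h3

/-- A direction along which a closed convex set has arbitrarily distant points is a recession
direction. -/
theorem recession_of_unbounded {C : Set (Fin m → ℝ)} (hC : Convex ℝ C) (hcl : IsClosed C)
    {a d : Fin m → ℝ} (h : ∀ k : ℕ, ∃ c : ℝ, k ≤ c ∧ a + c • d ∈ C) {x : Fin m → ℝ}
    (hx : x ∈ C) {t : ℝ} (ht : 0 ≤ t) : x + t • d ∈ C := by
  choose c hc hmem using h
  have hc' : Tendsto c atTop atTop := tendsto_atTop_mono hc tendsto_natCast_atTop_atTop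
  -- The point at step `k` is the convex combination of `x` and `a + c k • d` with weight `t / c k`
  -- on the latter, hence lies in `C` as soon as `c k ≥ max t 1`.
  have hlim : Tendsto (fun k => x + t • d + (t / c k) • (a - x)) atTop (𝓝 (x + t • d)) := by
    have : Tendsto (fun k => t / c k) atTop (𝓝 0) := hc'.const_div_atTop t
    simpa using (this.smul_const (a - x)).const_add (x + t • d)
  refine hcl.mem_of_tendsto hlim ?_
  filter_upwards [hc'.eventually_ge_atTop (max t 1)] with k hk
  have hpos : 0 < c k := lt_of_lt_of_le one_pos ((le_max_right _ _).trans hk)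
  have hle : t / c k ≤ 1 := (div_le_one hpos).2 ((le_max_left _ _).trans hk)
  have := hC hx (hmem k) (sub_nonneg.2 hle) (div_nonneg ht hpos.le) (by ring)
  convert this using 1
  rw [smul_add, smul_smul, div_mul_cancel₀ _ hpos.ne', sub_smul, one_smul, smul_sub]
  abel

end RayCone

open scoped Computability

/-! ### Describing a language by base words and pumpable factors. -/

section PumpBase

/-- `B` and `P` describe a language `L` up to pumping: `B` consists of words of `L`, every
`(x, z) ∈ P` has the form `(v ++ z, z)` where `v` can be pumped in front of `z`, and every word
of `L` lies in `B` or can be shortened by removing such a factor `v`. -/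
structure IsPumpBase {A : Type*} (L : Language A) (B : Set (List A))
    (P : Set (List A × List A)) : Prop where
  base_mem : ∀ w ∈ B, w ∈ L
  pump_mem : ∀ p ∈ P, ∃ u v, p.1 = v ++ p.2 ∧
    ∀ k : ℕ, u ++ ((List.replicate k v).flatten ++ p.2) ∈ L
  reduce : ∀ w ∈ L, w ∈ B ∨
    ∃ u v z, w = u ++ (v ++ z) ∧ v ≠ [] ∧ u ++ z ∈ L ∧ (v ++ z, z) ∈ P

/-- The deleted factor is nonempty, so reduction shortens the word and must end in `B`. -/
theorem IsPumpBase.induction {A : Type*} {L : Language A} {B : Set (List A)}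
    {P : Set (List A × List A)} (h : IsPumpBase L B P) {Q : List A → Prop}
    (base : ∀ w ∈ B, Q w)
    (pump : ∀ u v z, (v ++ z, z) ∈ P → Q (u ++ z) → Q (u ++ (v ++ z))) :
    ∀ w ∈ L, Q w := by
  intro w
  induction hn : w.length using Nat.strong_induction_on generalizing w with
  | _ n ih =>
    intro hw
    rcases h.reduce w hw with hB | ⟨u, v, z, rfl, hv, huz, hP⟩
    · exact base w hB
    · refine pump u v z hP (ih _ ?_ _ rfl huz)
      have := List.length_pos_of_ne_nil hv
      simp only [List.length_append] at hn ⊢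
      omega

theorem IsPumpBase.nonempty {A : Type*} {L : Language A} {B : Set (List A)}
    {P : Set (List A × List A)} (h : IsPumpBase L B P) {w : List A} (hw : w ∈ L) :
    B.Nonempty :=
  h.induction (Q := fun _ => B.Nonempty) (fun w hw => ⟨w, hw⟩) (fun _ _ _ _ h => h) w hw

end PumpBase

/-! ### From pump bases to rays; the polyhedrality statement. -/

section Rho

variable {r m : ℕ}

theorem rho_append (u v : List (DigitVector r m)) :
    rho (u ++ v) = rho u + r ^ u.length • rho v := by
  funext j
  simp [rho, Nat.ofDigits_append]

/-- The vector represented by a word, with real coordinates. -/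
def realRho (w : List (DigitVector r m)) : Fin m → ℝ := fun j => (rho w j : ℝ)

theorem realRho_append (u v : List (DigitVector r m)) :
    realRho (u ++ v) = realRho u + (r : ℝ) ^ u.length • realRho v := by
  funext j
  simp [realRho, rho_append]

/-- The ray standing for the vector represented by a word. -/
def wordRay (w : List (DigitVector r m)) : (Fin m → ℝ) × ℝ := (realRho w, 1)

/-- The ray standing for the recession direction `ρ(x) - ρ(z)`. -/
def pumpRay (p : List (DigitVector r m) × List (DigitVector r m)) : (Fin m → ℝ) × ℝ :=
  (realRho p.1 - realRho p.2, 0)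

/-- The prefix `u` enters only through the positive scalar `r ^ |u|`. Hence a pump pair need not
record it. -/
theorem wordRay_insert (u v z : List (DigitVector r m)) :
    wordRay (u ++ (v ++ z)) = wordRay (u ++ z) + (r : ℝ) ^ u.length • pumpRay (v ++ z, z) := by
  refine Prod.ext ?_ ?_
  · simp only [wordRay, pumpRay, realRho_append u, Prod.fst_add, Prod.smul_fst, smul_sub]
    abel
  · simp [wordRay, pumpRay]

/-- A further copy of `v`, placed directly before `z`, adds a power of `r` times the same vector.
These powers are at least 1, so `k` copies add at least `k` times that vector; for `k = 0` the word
is `u ++ z`. -/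
theorem realRho_pump (hr : 2 ≤ r) (u v z : List (DigitVector r m)) (k : ℕ) :
    ∃ c : ℝ, k ≤ c ∧ realRho (u ++ ((List.replicate k v).flatten ++ z)) =
      realRho (u ++ z) + c • (realRho (v ++ z) - realRho z) := by
  have hr' : (1 : ℝ) ≤ r := by exact_mod_cast (by omega : 1 ≤ r)
  induction k with
  | zero => exact ⟨0, by simp, by simp⟩
  | succ k ih =>
    obtain ⟨c, hc, h⟩ := ih
    refine ⟨c + (r : ℝ) ^ (u ++ (List.replicate k v).flatten).length, ?_, ?_⟩
    · push_cast
      exact add_le_add hc (one_le_pow₀ hr')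
    · have h1 : u ++ ((List.replicate (k + 1) v).flatten ++ z) =
          (u ++ (List.replicate k v).flatten) ++ (v ++ z) := by
        simp [List.replicate_succ', List.flatten_append]
      rw [add_smul, ← add_assoc, ← h, h1, ← List.append_assoc u, realRho_append _ (v ++ z),
        realRho_append (u ++ _) z, smul_sub]
      abel

/-- The closed convex hull of `ρ(L)` is represented by the rays of a pump base of `L`. -/
theorem IsPumpBase.closure_convexHull_eq (hr : 2 ≤ r) {L : Language (DigitVector r m)}
    {B : Set (List (DigitVector r m))} {P : Set (List (DigitVector r m) × List (DigitVector r m))}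
    (h : IsPumpBase L B P) (R : Finset ((Fin m → ℝ) × ℝ)) (hB : ∀ w ∈ B, wordRay w ∈ R)
    (hP : ∀ p ∈ P, pumpRay p ∈ R)
    (hR : ∀ q ∈ R, q = 0 ∨ (∃ w ∈ B, q = wordRay w) ∨ ∃ p ∈ P, q = pumpRay p) :
    closure (convexHull ℝ (representedSet L)) = {x | (x, 1) ∈ rayCone R} := by
  have hpoly := IsPolyhedralConvex.of_cone (isPolyhedralCone_rayCone R)
  have hmem : ∀ w ∈ L, realRho w ∈ closure (convexHull ℝ (representedSet L)) := fun w hw =>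
    subset_closure (subset_convexHull ℝ _ ⟨w, hw, rfl⟩)
  apply Set.Subset.antisymm
  -- The right-hand side is polyhedral, hence closed and convex; it suffices to locate the words of
  -- `L` themselves.
  · refine closure_minimal (convexHull_min ?_ hpoly.convex) hpoly.isClosed
    rintro _ ⟨w, hw, rfl⟩
    change wordRay w ∈ rayCone R
    refine h.induction (Q := fun w => wordRay w ∈ rayCone R)
      (fun w hw => mem_rayCone_of_mem (hB w hw)) (fun u v z hvz huz => ?_) w hw
    rw [wordRay_insert]
    exact add_mem_rayCone huz (smul_mem_rayCone (mem_rayCone_of_mem (hP _ hvz)) (by positivity))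
  · intro x hx
    have hconv : Convex ℝ (closure (convexHull ℝ (representedSet L))) :=
      (convex_convexHull ℝ _).closure
    refine mem_of_mem_rayCone hconv (fun q hq => ?_) hx
    rcases hR q hq with rfl | ⟨w, hw, rfl⟩ | ⟨⟨y, z⟩, hp, rfl⟩
    -- The zero ray is harmless as a direction; it is what a failed scan will produce.
    · exact Or.inr ⟨rfl, fun x hx t _ => by simpa using hx⟩
    · exact Or.inl ⟨rfl, hmem w (h.base_mem w hw)⟩
    · obtain ⟨u, v, hyz, hk⟩ := h.pump_mem _ hp
      obtain rfl : y = v ++ z := hyz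
      refine Or.inr ⟨rfl, fun x hx t ht =>
        recession_of_unbounded hconv isClosed_closure (a := realRho (u ++ z)) (fun k => ?_) hx ht⟩
      obtain ⟨c, hc, hck⟩ := realRho_pump hr u v z k
      exact ⟨c, hc, by simpa only [pumpRay, hck] using hmem _ (hk k)⟩

/-- A deterministic automaton yields a finite pump base of its language. -/
theorem DFA.isPumpBase {A σ : Type*} [Fintype σ] (M : DFA A σ) :
    IsPumpBase M.accepts {w | w ∈ M.accepts ∧ w.length ≤ Fintype.card σ}
      {p | p.1.length ≤ Fintype.card σ ∧ ∃ u v, p.1 = v ++ p.2 ∧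
        ∀ k : ℕ, u ++ ((List.replicate k v).flatten ++ p.2) ∈ M.accepts} where
  base_mem _ hw := hw.1
  pump_mem _ hp := hp.2
  reduce w hw := by
    rcases le_or_gt w.length (Fintype.card σ) with hle | hlt
    · exact Or.inl ⟨hw, hle⟩
    -- The repeated state is sought in the last `card σ` letters. This bounds the length of `b ++
    -- c`, not just that of `b`, so that only finitely many pairs arise.
    · obtain ⟨y, x, rfl, hx⟩ : ∃ y x, w = y ++ x ∧ x.length = Fintype.card σ :=
        ⟨w.take (w.length - Fintype.card σ), w.drop (w.length - Fintype.card σ),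
          (List.take_append_drop _ _).symm, by simp; omega⟩
      obtain ⟨q, a, b, c, rfl, -, hb, ha, hq, hc⟩ :=
        M.evalFrom_split (s := M.eval y) hx.ge rfl
      have hmem : ∀ k : ℕ, y ++ a ++ ((List.replicate k b).flatten ++ c) ∈ M.accepts := by
        intro k
        have hk : M.evalFrom q (List.replicate k b).flatten = q := by
          induction k with
          | zero => rfl
          | succ k ih => rw [List.replicate_succ, List.flatten_cons, DFA.evalFrom_of_append, hq, ih]
        rw [DFA.mem_accepts] at hw ⊢
        rw [DFA.eval, DFA.evalFrom_of_append, DFA.evalFrom_of_append, DFA.evalFrom_of_append,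
          show M.evalFrom M.start y = M.eval y from rfl, ha, hk, hc]
        rwa [DFA.eval, DFA.evalFrom_of_append] at hw
      refine Or.inr ⟨y ++ a, b, c, by simp, hb, by simpa using hmem 0, ?_, y ++ a, b, rfl, hmem⟩
      simp only [List.length_append] at hx ⊢
      omega

theorem isPolyhedralConvex_of_isRegular (hr : 2 ≤ r) {L : Language (DigitVector r m)}
    (hL : L.IsRegular) : IsPolyhedralConvex (closure (convexHull ℝ (representedSet L))) := by
  classical
  obtain ⟨σ, _, M, rfl⟩ := hL
  have hB : {w | w ∈ M.accepts ∧ w.length ≤ Fintype.card σ}.Finite :=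
    (List.finite_length_le _ (Fintype.card σ)).subset fun w hw => hw.2
  have hP : {p : List (DigitVector r m) × List (DigitVector r m) |
      p.1.length ≤ Fintype.card σ ∧ ∃ u v, p.1 = v ++ p.2 ∧
        ∀ k : ℕ, u ++ ((List.replicate k v).flatten ++ p.2) ∈ M.accepts}.Finite := by
    refine ((List.finite_length_le _ (Fintype.card σ)).prod
      (List.finite_length_le _ (Fintype.card σ))).subset ?_
    rintro ⟨x, z⟩ ⟨hx, u, v, hxz, -⟩
    refine ⟨hx, ?_⟩
    obtain rfl : x = v ++ z := hxz
    change z.length ≤ _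
    change (v ++ z).length ≤ _ at hx
    rw [List.length_append] at hx
    omega
  rw [M.isPumpBase.closure_convexHull_eq hr ((hB.image wordRay).toFinset ∪
    (hP.image pumpRay).toFinset)]
  · exact IsPolyhedralConvex.of_cone (isPolyhedralCone_rayCone _)
  · intro w hw
    exact Finset.mem_union_left _ ((Set.Finite.mem_toFinset _).2 ⟨w, hw, rfl⟩)
  · intro p hp
    exact Finset.mem_union_right _ ((Set.Finite.mem_toFinset _).2 ⟨p, hp, rfl⟩)
  · intro q hq
    simp only [Finset.mem_union, Set.Finite.mem_toFinset, Set.mem_image] at hq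
    rcases hq with ⟨w, hw, rfl⟩ | ⟨p, hp, rfl⟩
    · exact Or.inr (Or.inl ⟨w, hw, rfl⟩)
    · exact Or.inr (Or.inr ⟨p, hp, rfl⟩)

end Rho

/-! ### Pump bases of regular expressions. -/

section Regex

variable {A : Type}

/-- The words of a regular expression that avoid all stars. -/
def baseWords : RegularExpression A → Set (List A)
  | .zero => ∅
  | .epsilon => {[]}
  | .char a => {[a]}
  | .plus e f => baseWords e ∪ baseWords f
  | .comp e f => Set.image2 (· ++ ·) (baseWords e) (baseWords f)
  | .star _ => {[]}

/-- Pairs `(v ++ z, z)` such that the regular expression allows to pump `v` in front of `z`. -/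
def pumpPairs : RegularExpression A → Set (List A × List A)
  | .zero => ∅
  | .epsilon => ∅
  | .char _ => ∅
  | .plus e f => pumpPairs e ∪ pumpPairs f
  | .comp e f => {p | p ∈ pumpPairs f ∧ (baseWords e).Nonempty} ∪
      Set.image2 (fun p y => (p.1 ++ y, p.2 ++ y)) (pumpPairs e) (baseWords f)
  | .star e => pumpPairs e ∪ (fun v => (v, [])) '' baseWords e

/-- In a product, a left factor preceding the pumped position matters only through its existence,
whereas a right factor following it belongs to `z`. Therefore the right factor is reduced to a base
word before the left one is touched. In a star, the last iteration is reduced; once it is a base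
word it is deleted as a whole, with empty `z`. Thus no iterations ever follow the pumped factor. -/
theorem RegularExpression.isPumpBase (e : RegularExpression A) :
    IsPumpBase e.matches' (baseWords e) (pumpPairs e) := by
  induction e with
  | zero => exact ⟨by simp [baseWords], by simp [pumpPairs],
      fun w hw => absurd hw (Language.notMem_zero w)⟩
  | epsilon => exact ⟨fun w hw => hw, by simp [pumpPairs], fun w hw => Or.inl hw⟩
  | char a => exact ⟨fun w hw => hw, by simp [pumpPairs], fun w hw => Or.inl hw⟩
  | plus e f he hf =>
    refine ⟨?_, ?_, ?_⟩
    · rintro w (hw | hw)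
      · exact Or.inl (he.base_mem w hw)
      · exact Or.inr (hf.base_mem w hw)
    · rintro p (hp | hp)
      · obtain ⟨u, v, h1, h2⟩ := he.pump_mem p hp
        exact ⟨u, v, h1, fun k => Or.inl (h2 k)⟩
      · obtain ⟨u, v, h1, h2⟩ := hf.pump_mem p hp
        exact ⟨u, v, h1, fun k => Or.inr (h2 k)⟩
    · rintro w (hw | hw)
      · rcases he.reduce w hw with h | ⟨u, v, z, rfl, hv, huz, hP⟩
        · exact Or.inl (Or.inl h)
        · exact Or.inr ⟨u, v, z, rfl, hv, Or.inl huz, Or.inl hP⟩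
      · rcases hf.reduce w hw with h | ⟨u, v, z, rfl, hv, huz, hP⟩
        · exact Or.inl (Or.inr h)
        · exact Or.inr ⟨u, v, z, rfl, hv, Or.inr huz, Or.inr hP⟩
  | comp e f he hf =>
    refine ⟨?_, ?_, ?_⟩
    · rintro _ ⟨x, hx, y, hy, rfl⟩
      exact Language.append_mem_mul (he.base_mem x hx) (hf.base_mem y hy)
    · rintro _ (⟨hp, x, hx⟩ | ⟨p, hp, y, hy, rfl⟩)
      · obtain ⟨u, v, h1, h2⟩ := hf.pump_mem _ hp
        refine ⟨x ++ u, v, h1, fun k => ?_⟩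
        rw [List.append_assoc]
        exact Language.append_mem_mul (he.base_mem x hx) (h2 k)
      · obtain ⟨u, v, h1, h2⟩ := he.pump_mem _ hp
        refine ⟨u, v, by simp [h1], fun k => ?_⟩
        have := Language.append_mem_mul (h2 k) (hf.base_mem y hy)
        simpa using this
    · rintro _ ⟨x, hx, y, hy, rfl⟩
      rcases hf.reduce y hy with hyB | ⟨u, v, z, rfl, hv, huz, hP⟩
      · rcases he.reduce x hx with hxB | ⟨u, v, z, rfl, hv, huz, hP⟩
        · exact Or.inl ⟨x, hxB, y, hyB, rfl⟩
        · refine Or.inr ⟨u, v, z ++ y, by simp, hv, ?_, Or.inr ⟨_, hP, y, hyB, by simp⟩⟩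
          rw [← List.append_assoc]
          exact Language.append_mem_mul huz hy
      · refine Or.inr ⟨x ++ u, v, z, by simp, hv, ?_, Or.inl ⟨hP, he.nonempty hx⟩⟩
        rw [List.append_assoc]
        exact Language.append_mem_mul hx huz
  | star e he =>
    have hstar : ∀ w ∈ e.matches', w ∈ e.matches'∗ := fun w hw =>
      Language.mem_kstar.2 ⟨[w], by simp, by simpa using hw⟩
    refine ⟨?_, ?_, ?_⟩
    · rintro w rfl
      exact Language.nil_mem_kstar _
    · rintro _ (hp | ⟨v, hv, rfl⟩)
      · obtain ⟨u, v, h1, h2⟩ := he.pump_mem _ hp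
        exact ⟨u, v, h1, fun k => hstar _ (h2 k)⟩
      · refine ⟨[], v, by simp, fun k => Language.mem_kstar.2 ⟨List.replicate k v, by simp, ?_⟩⟩
        intro y hy
        rw [List.eq_of_mem_replicate hy]
        exact he.base_mem v hv
    · intro w hw
      -- Empty iterations are discarded so that the deleted factor is nonempty.
      obtain ⟨S, rfl, hS⟩ := Language.mem_kstar_iff_exists_nonempty.1 hw
      induction S using List.reverseRecOn with
      | nil => exact Or.inl rfl
      | append_singleton S y =>
        right
        have hy := hS y (by simp)
        have hS' : ∀ x ∈ S, x ∈ e.matches' := fun x hx => (hS x (by simp [hx])).1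
        rcases he.reduce y hy.1 with hyB | ⟨u, v, z, rfl, hv, huz, hP⟩
        · exact ⟨S.flatten, y, [], by simp, hy.2,
            Language.mem_kstar.2 ⟨S, by simp, hS'⟩, Or.inr ⟨y, hyB, by simp⟩⟩
        · refine ⟨S.flatten ++ u, v, z, by simp, hv,
            Language.mem_kstar.2 ⟨S ++ [u ++ z], by simp, ?_⟩, Or.inl hP⟩
          intro x hx
          rcases List.mem_append.1 hx with hx | hx
          · exact hS' x hx
          · rw [List.mem_singleton.1 hx]
            exact huz

end Regex

/-! ### Generating base words and pump pairs by a nondeterministic scan from the root. -/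

/-- What is to be generated from a subexpression: nothing, nothing but a test that its language is
nonempty, a base word written to the first stack or to both stacks, or a pump pair. -/
inductive ScanMode : Type
  | skip
  | test
  | word
  | both
  | pump
  deriving DecidableEq

instance : Fintype ScanMode := ⟨{.skip, .test, .word, .both, .pump}, fun x => by cases x <;> simp⟩

section Scan

variable {A : Type}

/-- The modes of the subexpressions (the right one first) of an expression with a given root that
is treated in mode `μ`, depending on a choice; the token `none` starts the scan. -/
def pushedModes (μ : ScanMode) : Option (RegexToken A) × Bool → List ScanMode
  | (none, b) => [if b then .pump else .word]
  | (some .plus, b) => if b then [μ, .skip] else [.skip, μ]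
  | (some .comp, b) => if μ = .pump then (if b then [.pump, .test] else [.both, .pump]) else [μ, μ]
  | (some .star, b) => if μ = .pump then (if b then [.pump] else [.word]) else [.skip]
  | _ => []

/-- The letter written to the first stack. -/
def emitFst (μ : ScanMode) : Option (RegexToken A) × Bool → Option A
  | (some (.char a), _) => if μ = .word ∨ μ = .both then some a else none
  | _ => none

/-- The letter written to the second stack. -/
def emitSnd (μ : ScanMode) : Option (RegexToken A) × Bool → Option A
  | (some (.char a), _) => if μ = .both then some a else none
  | _ => none

/-- Whether a token is admissible in a given mode. -/
def tokenOk (μ : ScanMode) : Option (RegexToken A) × Bool → Bool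
  | (some .zero, _) => μ = .skip
  | (some .epsilon, _) => μ ≠ .pump
  | (some (.char _), _) => μ ≠ .pump
  | _ => true

/-- The starting token determines whether a word or a pump pair is generated. -/
def nextIsWord (w : Bool) : Option (RegexToken A) × Bool → Bool
  | (none, b) => !b
  | _ => w

/-- The state of a scan through a regular expression. -/
@[ext] structure ScanState (A : Type) where
  modes : List ScanMode
  fst : List A
  snd : List A
  ok : Bool
  isWord : Bool

/-- Processing a token together with a choice. -/
def scanStep (s : ScanState A) (t : Option (RegexToken A) × Bool) : ScanState A where
  modes := pushedModes (s.modes.head?.getD .skip) t ++ s.modes.tail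
  fst := (emitFst (s.modes.head?.getD .skip) t).toList ++ s.fst
  snd := (emitSnd (s.modes.head?.getD .skip) t).toList ++ s.snd
  ok := s.ok && tokenOk (s.modes.head?.getD .skip) t
  isWord := nextIsWord s.isWord t

/-- Processing a list of tokens with choices. -/
def scan (s : ScanState A) (l : List (Option (RegexToken A) × Bool)) : ScanState A :=
  l.foldl scanStep s

theorem scan_cons (s : ScanState A) (t) (l : List (Option (RegexToken A) × Bool)) :
    scan s (t :: l) = scan (scanStep s t) l := rfl

theorem scan_append (s : ScanState A) (l l' : List (Option (RegexToken A) × Bool)) :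
    scan s (l ++ l') = scan (scan s l) l' := List.foldl_append

theorem scan_fst_length_le (l : List (Option (RegexToken A) × Bool)) (s : ScanState A) :
    (scan s l).fst.length ≤ s.fst.length + l.length := by
  induction l generalizing s with
  | nil => exact le_rfl
  | cons t l ih =>
    refine (ih _).trans ?_
    simp only [scanStep, List.length_append, List.length_cons, Option.length_toList]
    split <;> omega

/-- A letter goes to the second stack only in mode `both`, when it also goes to the first. The
digitwise subtraction relies on this. -/
theorem scan_snd_length_le (l : List (Option (RegexToken A) × Bool)) (s : ScanState A)
    (hs : s.snd.length ≤ s.fst.length) : (scan s l).snd.length ≤ (scan s l).fst.length := by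
  induction l generalizing s with
  | nil => exact hs
  | cons t l ih =>
    refine ih _ ?_
    simp only [scanStep, List.length_append, Option.length_toList]
    rcases t with ⟨_ | _ | _ | a | _, b⟩ <;> simp only [emitFst, emitSnd] <;>
      split_ifs <;> simp_all
    omega

/-- What a successful scan of an expression generates. -/
def Generates (e : RegularExpression A) (x y : List A) : ScanMode → Prop
  | .skip => x = [] ∧ y = []
  | .test => x = [] ∧ y = [] ∧ (baseWords e).Nonempty
  | .word => x ∈ baseWords e ∧ y = []
  | .both => x ∈ baseWords e ∧ y = x
  | .pump => (x, y) ∈ pumpPairs e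

/-- The tokens of a regular expression, the root first. -/
def rootFirst (e : RegularExpression A) : List (Option (RegexToken A)) :=
  ((encodeRegex e).map some).reverse

theorem rootFirst_plus (e f : RegularExpression A) :
    rootFirst (.plus e f) = some .plus :: (rootFirst f ++ rootFirst e) := by
  simp [rootFirst, encodeRegex]

theorem rootFirst_comp (e f : RegularExpression A) :
    rootFirst (.comp e f) = some .comp :: (rootFirst f ++ rootFirst e) := by
  simp [rootFirst, encodeRegex]

theorem rootFirst_star (e : RegularExpression A) :
    rootFirst (.star e) = some .star :: rootFirst e := by
  simp [rootFirst, encodeRegex]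

/-- The effect of scanning a complete subexpression. -/
def ScanEffect (l : List (Option (RegexToken A) × Bool)) (μ : ScanMode) (x y : List A)
    (ok : Bool) : Prop :=
  ∀ modes fst snd ok' w, scan ⟨μ :: modes, fst, snd, ok', w⟩ l =
    ⟨modes, x ++ fst, y ++ snd, ok' && ok, w⟩

theorem ScanEffect.leaf (t : RegexToken A) (b : Bool) (μ : ScanMode)
    (h : pushedModes μ (some t, b) = []) :
    ScanEffect [(some t, b)] μ (emitFst μ (some t, b)).toList (emitSnd μ (some t, b)).toList
      (tokenOk μ (some t, b)) := by
  intro modes fst snd ok' w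
  simp [scan, scanStep, h, nextIsWord]

theorem ScanEffect.unary {l : List (Option (RegexToken A) × Bool)} {b : Bool} {μ ν : ScanMode}
    {x y : List A} {ok : Bool} (h : pushedModes (A := A) μ (some .star, b) = [ν])
    (hl : ScanEffect l ν x y ok) : ScanEffect ((some .star, b) :: l) μ x y ok := by
  intro modes fst snd ok' w
  rw [scan_cons, ← hl]
  simp [scanStep, h, emitFst, emitSnd, tokenOk, nextIsWord]

/-- The right operand is scanned first, so the output of the left one lands on top of it and words
come out in reading order. -/
theorem ScanEffect.binary {t : RegexToken A} {l₁ l₂ : List (Option (RegexToken A) × Bool)}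
    (ht : t = .plus ∨ t = .comp) {b : Bool} {μ ν₁ ν₂ : ScanMode} {x₁ y₁ x₂ y₂ : List A}
    {ok₁ ok₂ : Bool} (h : pushedModes μ (some t, b) = [ν₁, ν₂])
    (h₁ : ScanEffect l₁ ν₁ x₁ y₁ ok₁) (h₂ : ScanEffect l₂ ν₂ x₂ y₂ ok₂) :
    ScanEffect ((some t, b) :: (l₁ ++ l₂)) μ (x₂ ++ x₁) (y₂ ++ y₁) (ok₁ && ok₂) := by
  intro modes fst snd ok' w
  rw [scan_cons, scan_append, List.append_assoc, List.append_assoc, ← Bool.and_assoc,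
    ← h₂, ← h₁]
  rcases ht with rfl | rfl <;> simp [scanStep, h, emitFst, emitSnd, tokenOk, nextIsWord]

/-- Soundness. Whatever the choices, a subexpression consumes exactly its own mode, even when it is
skipped, so sibling subexpressions stay synchronized; inconsistent choices show up only in the flag.
-/
theorem exists_scanEffect (e : RegularExpression A) (l : List (Option (RegexToken A) × Bool))
    (hl : l.map Prod.fst = rootFirst e) (μ : ScanMode) :
    ∃ x y ok, ScanEffect l μ x y ok ∧ (ok = true → Generates e x y μ) := by
  induction e generalizing l μ with
  | zero =>
    obtain ⟨⟨_, b⟩, rfl, rfl⟩ := List.map_eq_singleton_iff.1 hl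
    refine ⟨_, _, _, .leaf _ _ _ rfl, fun h => ?_⟩
    obtain rfl : μ = .skip := by simpa [tokenOk] using h
    exact ⟨rfl, rfl⟩
  | epsilon =>
    obtain ⟨⟨_, b⟩, rfl, rfl⟩ := List.map_eq_singleton_iff.1 hl
    refine ⟨_, _, _, .leaf _ _ _ rfl, fun h => ?_⟩
    cases μ <;> simp_all [tokenOk, Generates, emitFst, emitSnd, baseWords]
  | char a =>
    obtain ⟨⟨_, b⟩, rfl, rfl⟩ := List.map_eq_singleton_iff.1 hl
    refine ⟨_, _, _, .leaf _ _ _ rfl, fun h => ?_⟩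
    cases μ <;> simp_all [tokenOk, Generates, emitFst, emitSnd, baseWords]
  | plus e f he hf =>
    rw [rootFirst_plus] at hl
    obtain ⟨⟨_, b⟩, l, rfl, rfl, hl'⟩ := List.map_eq_cons_iff.1 hl
    obtain ⟨l₁, l₂, rfl, h₁, h₂⟩ := List.map_eq_append_iff.1 hl'
    cases b
    · obtain ⟨x₁, y₁, ok₁, e₁, g₁⟩ := hf l₁ h₁ .skip
      obtain ⟨x₂, y₂, ok₂, e₂, g₂⟩ := he l₂ h₂ μ
      refine ⟨_, _, _, .binary (Or.inl rfl) rfl e₁ e₂, fun h => ?_⟩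
      rw [Bool.and_eq_true] at h
      obtain ⟨rfl, rfl⟩ := g₁ h.1
      have := g₂ h.2
      cases μ <;> simp_all [Generates, baseWords, pumpPairs]
    · obtain ⟨x₁, y₁, ok₁, e₁, g₁⟩ := hf l₁ h₁ μ
      obtain ⟨x₂, y₂, ok₂, e₂, g₂⟩ := he l₂ h₂ .skip
      refine ⟨_, _, _, .binary (Or.inl rfl) rfl e₁ e₂, fun h => ?_⟩
      rw [Bool.and_eq_true] at h
      obtain ⟨rfl, rfl⟩ := g₂ h.2
      have := g₁ h.1
      cases μ <;> simp_all [Generates, baseWords, pumpPairs]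
  | comp e f he hf =>
    rw [rootFirst_comp] at hl
    obtain ⟨⟨_, b⟩, l, rfl, rfl, hl'⟩ := List.map_eq_cons_iff.1 hl
    obtain ⟨l₁, l₂, rfl, h₁, h₂⟩ := List.map_eq_append_iff.1 hl'
    by_cases hμ : μ = .pump
    · subst hμ
      cases b
      · obtain ⟨x₁, y₁, ok₁, e₁, g₁⟩ := hf l₁ h₁ .both
        obtain ⟨x₂, y₂, ok₂, e₂, g₂⟩ := he l₂ h₂ .pump
        refine ⟨_, _, _, .binary (Or.inr rfl) rfl e₁ e₂, fun h => ?_⟩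
        rw [Bool.and_eq_true] at h
        obtain ⟨hx, rfl⟩ := g₁ h.1
        exact Or.inr ⟨(x₂, y₂), g₂ h.2, _, hx, rfl⟩
      · obtain ⟨x₁, y₁, ok₁, e₁, g₁⟩ := hf l₁ h₁ .pump
        obtain ⟨x₂, y₂, ok₂, e₂, g₂⟩ := he l₂ h₂ .test
        refine ⟨_, _, _, .binary (Or.inr rfl) rfl e₁ e₂, fun h => ?_⟩
        rw [Bool.and_eq_true] at h
        obtain ⟨rfl, rfl, hne⟩ := g₂ h.2
        exact Or.inl ⟨g₁ h.1, hne⟩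
    · obtain ⟨x₁, y₁, ok₁, e₁, g₁⟩ := hf l₁ h₁ μ
      obtain ⟨x₂, y₂, ok₂, e₂, g₂⟩ := he l₂ h₂ μ
      refine ⟨_, _, _, .binary (Or.inr rfl) (if_neg hμ) e₁ e₂, fun h => ?_⟩
      rw [Bool.and_eq_true] at h
      have g₁ := g₁ h.1
      have g₂ := g₂ h.2
      cases μ
      · exact ⟨by simp [g₁.1, g₂.1], by simp [g₁.2, g₂.2]⟩
      · exact ⟨by simp [g₁.1, g₂.1], by simp [g₁.2.1, g₂.2.1], g₂.2.2.image2 g₁.2.2⟩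
      · exact ⟨⟨_, g₂.1, _, g₁.1, rfl⟩, by simp [g₁.2, g₂.2]⟩
      · exact ⟨⟨_, g₂.1, _, g₁.1, rfl⟩, by simp [g₁.2, g₂.2]⟩
      · exact absurd rfl hμ
  | star e he =>
    rw [rootFirst_star] at hl
    obtain ⟨⟨_, b⟩, l, rfl, rfl, hl'⟩ := List.map_eq_cons_iff.1 hl
    by_cases hμ : μ = .pump
    · subst hμ
      cases b
      · obtain ⟨x, y, ok, e₁, g⟩ := he l hl' .word
        refine ⟨_, _, _, .unary rfl e₁, fun h => ?_⟩
        obtain ⟨hx, rfl⟩ := g h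
        exact Or.inr ⟨x, hx, rfl⟩
      · obtain ⟨x, y, ok, e₁, g⟩ := he l hl' .pump
        exact ⟨_, _, _, .unary rfl e₁, fun h => Or.inl (g h)⟩
    · obtain ⟨x, y, ok, e₁, g⟩ := he l hl' .skip
      refine ⟨_, _, _, .unary (if_neg hμ) e₁, fun h => ?_⟩
      obtain ⟨rfl, rfl⟩ := g h
      cases μ <;> simp_all [Generates, baseWords]

/-- Completeness: the way in which `x` and `y` arise dictates the choice at each operator. Where a
choice is immaterial, `false` is taken. -/
theorem Generates.exists_scanEffect {e : RegularExpression A} {x y : List A} {μ : ScanMode}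
    (h : Generates e x y μ) :
    ∃ l : List (Option (RegexToken A) × Bool), l.map Prod.fst = rootFirst e ∧
      ScanEffect l μ x y true := by
  induction e generalizing x y μ with
  | zero =>
    refine ⟨[(some .zero, false)], rfl, ?_⟩
    cases μ <;> simp [Generates, baseWords, pumpPairs] at h
    obtain ⟨rfl, rfl⟩ := h
    exact .leaf _ _ _ rfl
  | epsilon =>
    refine ⟨[(some .epsilon, false)], rfl, ?_⟩
    have := ScanEffect.leaf (A := A) .epsilon false μ rfl
    cases μ <;> simp_all [Generates, baseWords, pumpPairs, emitFst, emitSnd, tokenOk]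
  | char a =>
    refine ⟨[(some (.char a), false)], rfl, ?_⟩
    have := ScanEffect.leaf (A := A) (.char a) false μ rfl
    cases μ <;> simp_all [Generates, baseWords, pumpPairs, emitFst, emitSnd, tokenOk]
  | plus e f he hf =>
    have hef : Generates e x y μ ∨ Generates f x y μ := by
      cases μ
      · exact Or.inl h
      · obtain ⟨rfl, rfl, _, h | h⟩ := h
        · exact Or.inl ⟨rfl, rfl, _, h⟩
        · exact Or.inr ⟨rfl, rfl, _, h⟩
      · obtain ⟨h | h, rfl⟩ := h
        · exact Or.inl ⟨h, rfl⟩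
        · exact Or.inr ⟨h, rfl⟩
      · obtain ⟨h | h, rfl⟩ := h
        · exact Or.inl ⟨h, rfl⟩
        · exact Or.inr ⟨h, rfl⟩
      · obtain h | h := h
        · exact Or.inl h
        · exact Or.inr h
    rcases hef with h | h
    · obtain ⟨l, hl, hs⟩ := he h
      obtain ⟨l', hl', hs'⟩ := hf (x := []) (y := []) (μ := .skip) ⟨rfl, rfl⟩
      refine ⟨(some .plus, false) :: (l' ++ l), by rw [rootFirst_plus]; simp [hl, hl'], ?_⟩
      simpa using ScanEffect.binary (Or.inl rfl) rfl hs' hs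
    · obtain ⟨l, hl, hs⟩ := hf h
      obtain ⟨l', hl', hs'⟩ := he (x := []) (y := []) (μ := .skip) ⟨rfl, rfl⟩
      refine ⟨(some .plus, true) :: (l ++ l'), by rw [rootFirst_plus]; simp [hl, hl'], ?_⟩
      simpa using ScanEffect.binary (Or.inl rfl) rfl hs hs'
  | comp e f he hf =>
    obtain ⟨b, ν₁, ν₂, x₁, y₁, x₂, y₂, hν, rfl, rfl, h₁, h₂⟩ : ∃ b ν₁ ν₂ x₁ y₁ x₂ y₂,
        pushedModes (A := A) μ (some .comp, b) = [ν₁, ν₂] ∧ x = x₂ ++ x₁ ∧ y = y₂ ++ y₁ ∧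
        Generates f x₁ y₁ ν₁ ∧ Generates e x₂ y₂ ν₂ := by
      cases μ
      · obtain ⟨rfl, rfl⟩ := h
        exact ⟨false, _, _, [], [], [], [], rfl, rfl, rfl, ⟨rfl, rfl⟩, ⟨rfl, rfl⟩⟩
      · obtain ⟨rfl, rfl, _, u, hu, v, hv, rfl⟩ := h
        exact ⟨false, _, _, [], [], [], [], rfl, rfl, rfl, ⟨rfl, rfl, v, hv⟩, ⟨rfl, rfl, u, hu⟩⟩
      · obtain ⟨⟨u, hu, v, hv, rfl⟩, rfl⟩ := h
        exact ⟨false, _, _, _, [], _, [], rfl, rfl, rfl, ⟨hv, rfl⟩, ⟨hu, rfl⟩⟩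
      · obtain ⟨⟨u, hu, v, hv, rfl⟩, rfl⟩ := h
        exact ⟨false, _, _, _, _, _, _, rfl, rfl, rfl, ⟨hv, rfl⟩, ⟨hu, rfl⟩⟩
      · rcases h with ⟨hp, hne⟩ | ⟨⟨u, v⟩, hp, z, hz, h⟩
        · exact ⟨true, _, _, _, _, [], [], rfl, rfl, rfl, hp, ⟨rfl, rfl, hne⟩⟩
        · obtain ⟨rfl, rfl⟩ := Prod.mk.inj h
          exact ⟨false, _, _, z, z, u, v, rfl, rfl, rfl, ⟨hz, rfl⟩, hp⟩
    obtain ⟨l₁, hl₁, hs₁⟩ := hf h₁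
    obtain ⟨l₂, hl₂, hs₂⟩ := he h₂
    exact ⟨(some .comp, b) :: (l₁ ++ l₂), by rw [rootFirst_comp]; simp [hl₁, hl₂],
      ScanEffect.binary (Or.inr rfl) hν hs₁ hs₂⟩
  | star e he =>
    obtain ⟨b, ν, hν, hg⟩ : ∃ b ν, pushedModes (A := A) μ (some .star, b) = [ν] ∧
        Generates e x y ν := by
      cases μ
      · exact ⟨false, _, rfl, h⟩
      · exact ⟨false, _, rfl, h.1, h.2.1⟩
      · exact ⟨false, .skip, rfl, h⟩
      · obtain ⟨h1, rfl⟩ := h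
        exact ⟨false, .skip, rfl, h1, h1⟩
      · obtain h | ⟨v, hv, h⟩ := h
        · exact ⟨true, _, rfl, h⟩
        · obtain ⟨rfl, rfl⟩ := Prod.mk.inj h
          exact ⟨false, .word, rfl, hv, rfl⟩
    obtain ⟨l, hl, hs⟩ := he hg
    exact ⟨(some .star, b) :: l, by rw [rootFirst_star]; simp [hl], .unary hν hs⟩

end Scan

/-! ### Choices as the digits of a binary counter. -/

section Bits

variable {τ : Type*}

/-- Tagging the entries of a list with the binary digits of a number. -/
def tagBits : List τ → ℕ → List (τ × Bool)
  | [], _ => []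
  | t :: l, k => (t, decide (k % 2 = 1)) :: tagBits l (k / 2)

/-- Adding a carry to a number given by tags. -/
def addCarry : Bool → List (τ × Bool) → List (τ × Bool)
  | _, [] => []
  | c, (t, b) :: l => (t, xor b c) :: addCarry (b && c) l

/-- The carry left after adding a carry to a number given by tags. -/
def carryOut : Bool → List (τ × Bool) → Bool
  | c, [] => c
  | c, (_, b) :: l => carryOut (b && c) l

theorem length_tagBits (l : List τ) (k : ℕ) : (tagBits l k).length = l.length := by
  induction l generalizing k with
  | nil => rfl
  | cons t l ih => simp [tagBits, ih]

theorem map_fst_tagBits (l : List τ) (k : ℕ) : (tagBits l k).map Prod.fst = l := by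
  induction l generalizing k with
  | nil => rfl
  | cons t l ih => simp [tagBits, ih]

theorem tagBits_zero (l : List τ) : tagBits l 0 = l.map fun t => (t, false) := by
  induction l with
  | nil => rfl
  | cons t l ih => simp [tagBits, ih]

/-- Tags record a number only modulo `2 ^ l.length`, so no bound on `k` is needed. -/
theorem addCarry_tagBits (c : Bool) (l : List τ) (k : ℕ) :
    addCarry c (tagBits l k) = tagBits l (k + c.toNat) := by
  induction l generalizing k c with
  | nil => rfl
  | cons t l ih =>
    simp only [tagBits, addCarry, ih]
    rcases Nat.mod_two_eq_zero_or_one k with h | h <;> cases c <;> simp [h]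
    · exact ⟨by omega, by congr 1; omega⟩
    · exact ⟨by omega, by congr 1; omega⟩

/-- Overflow occurs exactly when all choices have been enumerated; this is the stopping test of the
machine. -/
theorem carryOut_tagBits (c : Bool) (l : List τ) {k : ℕ} (hk : k < 2 ^ l.length) :
    carryOut c (tagBits l k) = decide (k + c.toNat = 2 ^ l.length) := by
  induction l generalizing k c with
  | nil =>
    obtain rfl : k = 0 := by simpa using hk
    cases c <;> simp [tagBits, carryOut]
  | cons t l ih =>
    rw [List.length_cons, pow_succ] at hk ⊢
    simp only [tagBits, carryOut]
    rw [ih _ (by omega)]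
    rcases Nat.mod_two_eq_zero_or_one k with h | h <;> cases c <;>
      simp only [h, Bool.toNat_true, Bool.toNat_false, Bool.and_true, Bool.and_false, decide_true,
        zero_ne_one, decide_false, decide_eq_decide] <;> omega

theorem exists_tagBits (l : List (τ × Bool)) :
    ∃ k < 2 ^ l.length, tagBits (l.map Prod.fst) k = l := by
  induction l with
  | nil => exact ⟨0, by simp, rfl⟩
  | cons t l ih =>
    obtain ⟨t, b⟩ := t
    obtain ⟨k, hk, h⟩ := ih
    refine ⟨2 * k + b.toNat, ?_, ?_⟩
    · have := b.toNat_lt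
      rw [List.length_cons, pow_succ]
      omega
    · have h2 : (2 * k + b.toNat) / 2 = k := by
        have := b.toNat_lt
        omega
      rw [List.map_cons, tagBits, h2, h]
      cases b <;> simp

end Bits

/-! ### Subtraction of digit words with borrows. -/

section Subtraction

variable {r m : ℕ}

theorem rho_cons (a : DigitVector r m) (x : List (DigitVector r m)) (j : Fin m) :
    rho (a :: x) j = a j + r * rho x j := by
  simp [rho, Nat.ofDigits_cons]

theorem rho_lt (hr : 2 ≤ r) (x : List (DigitVector r m)) (j : Fin m) :
    rho x j < r ^ x.length := by
  have := Nat.ofDigits_lt_base_pow_length (b := r) (l := x.map fun b => (b j : ℕ)) hr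
    (by simp)
  simpa [rho] using this

/-- The value of a component of a digit vector that may be missing. -/
def optDigit (b : Option (DigitVector r m)) (j : Fin m) : ℕ := b.elim 0 fun b => (b j : ℕ)

theorem rho_eq_optDigit (y : List (DigitVector r m)) (j : Fin m) :
    rho y j = optDigit y.head? j + r * rho y.tail j := by
  cases y with
  | nil => simp [rho, optDigit]
  | cons b y => simp [rho_cons, optDigit]

variable [NeZero r]

/-- The digits of the difference of two digit vectors, given the borrows. -/
def subDigit (c : Fin m → Bool) (a : DigitVector r m) (b : Option (DigitVector r m)) :
    DigitVector r m :=
  fun j => Fin.ofNat r (a j + r - (optDigit b j + (c j).toNat))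

/-- The borrows in the subtraction of two digit vectors. -/
def subBorrow (c : Fin m → Bool) (a : DigitVector r m) (b : Option (DigitVector r m)) :
    Fin m → Bool :=
  fun j => decide ((a j : ℕ) < optDigit b j + (c j).toNat)

/-- The subtraction of words of digit vectors. -/
def subDigits : (Fin m → Bool) → List (DigitVector r m) → List (DigitVector r m) →
    List (DigitVector r m)
  | _, [], _ => []
  | c, a :: x, y => subDigit c a y.head? :: subDigits (subBorrow c a y.head?) x y.tail

theorem length_subDigits (c : Fin m → Bool) (x y : List (DigitVector r m)) :
    (subDigits c x y).length = x.length := by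
  induction x generalizing c y with
  | nil => rfl
  | cons a x ih => simp [subDigits, ih]

/-- Digit plus borrow is at most `(r - 1) + 1 = r`, so the natural-number subtraction in `subDigit`
is never truncated. -/
theorem subDigit_add (c : Fin m → Bool) (a : DigitVector r m) (b : Option (DigitVector r m))
    (j : Fin m) : (subDigit c a b j : ℕ) + (optDigit b j + (c j).toNat) =
      a j + r * (subBorrow c a b j).toNat := by
  have ha := (a j).isLt
  have hb : optDigit b j < r := by
    cases b with
    | none => exact NeZero.pos r
    | some b => exact (b j).isLt
  have hc := (c j).toNat_lt
  simp only [subDigit, subBorrow, Fin.ofNat]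
  by_cases h : (a j : ℕ) < optDigit b j + (c j).toNat
  · rw [Nat.mod_eq_of_lt (by omega)]
    simp only [h, decide_true, Bool.toNat_true]
    omega
  · rw [show (a j : ℕ) + r - (optDigit b j + (c j).toNat) =
      a j - (optDigit b j + (c j).toNat) + r by omega, Nat.add_mod_right,
      Nat.mod_eq_of_lt (by omega)]
    simp only [h, decide_false, Bool.toNat_false]
    omega

/-- Here `d` is the final borrow: without comparing the operands, the difference is correct modulo
`r ^ x.length`. -/
theorem exists_rho_subDigits (c : Fin m → Bool) (x y : List (DigitVector r m))
    (hxy : y.length ≤ x.length) (j : Fin m) :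
    ∃ d, rho (subDigits c x y) j + rho y j + (c j).toNat = rho x j + r ^ x.length * d := by
  induction x generalizing c y with
  | nil =>
    obtain rfl : y = [] := by simpa using hxy
    exact ⟨(c j).toNat, by simp [subDigits, rho]⟩
  | cons a x ih =>
    obtain ⟨d, hd⟩ := ih (subBorrow c a y.head?) y.tail
      (by simp only [List.length_tail, List.length_cons] at *; omega)
    refine ⟨d, ?_⟩
    have h := subDigit_add c a y.head? j
    rw [subDigits, rho_cons, rho_cons, rho_eq_optDigit y, List.length_cons, pow_succ]
    linear_combination h + r * hd

/-- The computed difference is below `r ^ x.length`, so `ρ(y) ≤ ρ(x)` rules out a final borrow. -/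
theorem rho_subDigits (hr : 2 ≤ r) (x y : List (DigitVector r m)) (hxy : y.length ≤ x.length)
    (j : Fin m) (h : rho y j ≤ rho x j) :
    rho (subDigits (fun _ => false) x y) j + rho y j = rho x j := by
  obtain ⟨d, hd⟩ := exists_rho_subDigits (fun _ => false) x y hxy j
  have hlt := rho_lt hr (subDigits (fun _ => false) x y) j
  rw [length_subDigits] at hlt
  simp only [Bool.toNat_false, add_zero] at hd
  rcases Nat.eq_zero_or_pos d with rfl | hpos
  · simpa using hd
  · have := Nat.le_mul_of_pos_right (r ^ x.length) hpos
    omega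

end Subtraction

/-! ### Writing numbers without superfluous zeros. -/

section Digits

variable {r m : ℕ}

/-- Writing the `j`-th components of digit vectors, most significant first, on a stack, without
superfluous zeros. -/
def emitDigits [NeZero r] (j : Fin m) : Bool → List (DigitVector r m) → List (RayToken r)
  | _, [] => []
  | nz, d :: l => emitDigits j (nz || decide (d j ≠ 0)) l ++
      (if nz || decide (d j ≠ 0) then [.digit (d j)] else [])

theorem emitDigits_concat [NeZero r] (j : Fin m) (nz : Bool) (l : List (DigitVector r m))
    (d : DigitVector r m) :
    emitDigits j nz (l ++ [d]) =
      (if nz ∨ rho (l ++ [d]) j ≠ 0 then [.digit (d j)] else []) ++ emitDigits j nz l := by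
  induction l generalizing nz with
  | nil => simp [emitDigits, rho]
  | cons a l ih =>
    rw [List.cons_append, emitDigits, ih, emitDigits, List.append_assoc]
    congr 1
    rw [rho_cons]
    have hr : r ≠ 0 := NeZero.ne r
    by_cases ha : a j = 0 <;> simp [ha, hr]

theorem encodeDigits_add (hr : 2 ≤ r) (x : Fin r) (y : ℕ) (h : (x : ℕ) + r * y ≠ 0) :
    encodeDigits hr (x + r * y) = .digit x :: encodeDigits hr y := by
  -- The membership proofs inside `pmap` depend on the list; generalizing the lists lets their
  -- equation be substituted.
  have key : ∀ (l l' : List ℕ) (hl : ∀ d ∈ l, d < r) (hl' : ∀ d ∈ l', d < r),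
      l = (x : ℕ) :: l' → l.pmap (fun d hd => RayToken.digit ⟨d, hd⟩) hl =
        .digit x :: l'.pmap (fun d hd => RayToken.digit ⟨d, hd⟩) hl' := by
    rintro _ l' hl hl' rfl
    simp
  refine key _ _ _ _ (Nat.digits_add r (by omega) _ _ x.isLt ?_)
  by_contra! h'
  simp [h'.1, h'.2] at h

theorem encodeDigits_zero (hr : 2 ≤ r) : encodeDigits hr 0 = [] := by
  simp [encodeDigits]

theorem rho_reverse_eq_zero [NeZero r] (l : List (DigitVector r m)) (j : Fin m) :
    rho l.reverse j = 0 ↔ rho l j = 0 := by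
  have : ∀ l : List (DigitVector r m), rho l j = 0 ↔ ∀ d ∈ l, d j = 0 := by
    intro l
    induction l with
    | nil => simp [rho]
    | cons a l ih =>
      have hr : r ≠ 0 := NeZero.ne r
      simp [rho_cons, ih, hr]
  rw [this, this]
  simp

/-- Digits are read most significant first, so leading zeros can be suppressed on the fly; pushing
them on a stack turns the result into least-significant-first order. -/
theorem emitDigits_reverse [NeZero r] (hr : 2 ≤ r) (j : Fin m) (l : List (DigitVector r m)) :
    emitDigits j false l.reverse = encodeDigits hr (rho l j) := by
  induction l with
  | nil => simp [emitDigits, rho, encodeDigits_zero]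
  | cons d l ih =>
    rw [List.reverse_cons, emitDigits_concat, ih, ← List.reverse_cons, rho_cons]
    have h := rho_reverse_eq_zero (d :: l) j
    rw [rho_cons] at h
    by_cases h0 : (d j : ℕ) + r * rho l j = 0
    · have hr0 : r ≠ 0 := NeZero.ne r
      have h1 : rho l j = 0 := by
        have := (Nat.add_eq_zero_iff.1 h0).2
        simpa [hr0] using this
      rw [if_neg (by rw [h.2 h0]; simp), h0, h1, encodeDigits_zero]
      rfl
    · rw [if_pos (Or.inr fun h' => h0 (h.1 h')), encodeDigits_add hr _ _ h0]
      rfl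

theorem encodeInt_natCast (hr : 2 ≤ r) (n : ℕ) :
    encodeInt hr (n : ℤ) = encodeDigits hr n ++ [.stop_mark] := by
  simp [encodeInt]

end Digits

/-! ### The list of rays and its correctness. -/

section Rays

variable {r m : ℕ} [NeZero r]

/-- The digits of the ray generated by a scan. -/
def rayDigits (s : ScanState (DigitVector r m)) : List (DigitVector r m) :=
  if s.ok then subDigits (fun _ => false) s.fst s.snd else []

/-- The ray generated by a scan. -/
def scanRay (s : ScanState (DigitVector r m)) : IntRay m :=
  (fun j => (rho (rayDigits s) j : ℤ), (s.ok && s.isWord).toNat)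

/-- The state in which a scan starts. -/
def startState (A : Type) : ScanState A := ⟨[], [], [], true, true⟩

/-- The ray generated by the choices given by the binary digits of a number. -/
def choiceRay (l : List (RegexToken (DigitVector r m))) (k : ℕ) : IntRay m :=
  scanRay (scan (startState _) (tagBits (l.map some ++ [none]) k).reverse)

/-- The rays generated by all choices. -/
def raysOfTokens (l : List (RegexToken (DigitVector r m))) : List (IntRay m) :=
  ((List.range (2 ^ (l.length + 1))).map (choiceRay l)).reverse

/-- A ray with real entries. -/
def realRay (p : IntRay m) : (Fin m → ℝ) × ℝ := (fun j => (p.1 j : ℝ), (p.2 : ℝ))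

omit [NeZero r] in
theorem exists_reverse_tagBits (e : RegularExpression (DigitVector r m)) (k : ℕ) :
    ∃ b l, (tagBits ((encodeRegex e).map some ++ [none]) k).reverse = (none, b) :: l ∧
      l.map Prod.fst = rootFirst e := by
  have h := map_fst_tagBits ((encodeRegex e).map some ++ [none]) k
  obtain ⟨l, l', hl, h1, h2⟩ := List.map_eq_append_iff.1 h
  obtain ⟨⟨_, b⟩, rfl, rfl⟩ := List.map_eq_singleton_iff.1 h2
  refine ⟨b, l.reverse, ?_, by rw [List.map_reverse, h1]; rfl⟩
  rw [hl, List.reverse_append, List.reverse_singleton, List.singleton_append]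

/-- The starting token meets an empty mode stack. The default mode read there is irrelevant, since
this token ignores its mode. -/
theorem scan_startState {A : Type} (b : Bool) (l : List (Option (RegexToken A) × Bool)) :
    scan (startState A) ((none, b) :: l) =
      scan ⟨[if b then .pump else .word], [], [], true, !b⟩ l := by
  simp [scan_cons, scanStep, startState, pushedModes, emitFst, emitSnd, tokenOk, nextIsWord]

theorem mem_raysOfTokens (e : RegularExpression (DigitVector r m)) (p : IntRay m) :
    p ∈ raysOfTokens (encodeRegex e) ↔
      ∃ b l, l.map Prod.fst = rootFirst e ∧
        p = scanRay (scan ⟨[if b then .pump else .word], [], [], true, !b⟩ l) := by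
  simp only [raysOfTokens, List.mem_reverse, List.mem_map, List.mem_range]
  constructor
  · rintro ⟨k, -, rfl⟩
    obtain ⟨b, l, h, hl⟩ := exists_reverse_tagBits e k
    exact ⟨b, l, hl, by rw [choiceRay, h, scan_startState]⟩
  · rintro ⟨b, l, hl, rfl⟩
    have hmap : (l.reverse ++ [(none, b)]).map Prod.fst = (encodeRegex e).map some ++ [none] := by
      rw [List.map_append, List.map_reverse, hl, rootFirst, List.reverse_reverse]
      rfl
    obtain ⟨k, hk, h⟩ := exists_tagBits (l.reverse ++ [(none, b)])
    have hlen := congrArg List.length hmap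
    simp only [List.length_map, List.length_append, List.length_singleton] at hlen
    rw [hmap] at h
    rw [List.length_append, List.length_singleton, hlen] at hk
    refine ⟨k, hk, ?_⟩
    rw [choiceRay, h, List.reverse_append, List.reverse_singleton, List.singleton_append,
      List.reverse_reverse, scan_startState]

theorem realRay_scanRay (hr : 2 ≤ r) (s : ScanState (DigitVector r m)) (hok : s.ok = true)
    (hlen : s.snd.length ≤ s.fst.length) (hle : ∀ j, rho s.snd j ≤ rho s.fst j) :
    realRay (scanRay s) = (realRho s.fst - realRho s.snd, (s.isWord.toNat : ℝ)) := by
  refine Prod.ext (funext fun j => ?_) (by simp [realRay, scanRay, hok])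
  have := rho_subDigits hr s.fst s.snd hlen j (hle j)
  simp only [realRay, scanRay, rayDigits, hok, if_true, realRho, Pi.sub_apply, Int.cast_natCast]
  rw [eq_sub_iff_add_eq]
  exact_mod_cast this

theorem realRay_scanRay_of_not_ok (s : ScanState (DigitVector r m)) (hok : s.ok = false) :
    realRay (scanRay s) = 0 := by
  refine Prod.ext (funext fun j => ?_) ?_ <;> simp [realRay, scanRay, rayDigits, hok, rho]

theorem realRay_of_base (hr : 2 ≤ r) (w : List (DigitVector r m)) :
    realRay (scanRay ⟨[], w, [], true, true⟩) = wordRay w := by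
  rw [realRay_scanRay hr _ rfl (by simp) (by simp [rho])]
  refine Prod.ext (funext fun j => ?_) ?_ <;> simp [wordRay, realRho, rho]

/-- Since `ρ(vz) = ρ(v) + r^|v| ρ(z)`, each coordinate satisfies `ρ(z) ≤ ρ(vz)`, and the subtraction
is exact. -/
theorem realRay_of_pump (hr : 2 ≤ r) (v z : List (DigitVector r m)) :
    realRay (scanRay ⟨[], v ++ z, z, true, false⟩) = pumpRay (v ++ z, z) := by
  rw [realRay_scanRay hr _ rfl (by simp)]
  · simp [pumpRay]
  · intro j
    simp only [rho_append, Pi.add_apply, Pi.smul_apply, smul_eq_mul]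
    have := Nat.le_mul_of_pos_left (rho z j) (Nat.pow_pos (n := v.length) (NeZero.pos r))
    omega

/-- Completeness of the scan puts all rays of the pump base into the list; soundness shows that the
list contains nothing else but possibly zero. -/
theorem isRepresentedByRays_raysOfTokens (hr : 2 ≤ r)
    (e : RegularExpression (DigitVector r m)) :
    IsRepresentedByRays (closure (convexHull ℝ (representedSet e.matches')))
      (realRays (raysOfTokens (encodeRegex e))) := by
  classical
  have hmem : ∀ q, q ∈ realRays (raysOfTokens (encodeRegex e)) ↔
      ∃ b l, l.map Prod.fst = rootFirst e ∧
        q = realRay (scanRay (scan ⟨[if b then .pump else .word], [], [], true, !b⟩ l)) := by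
    intro q
    rw [realRays, List.mem_toFinset, List.mem_map]
    constructor
    · rintro ⟨p, hp, rfl⟩
      obtain ⟨b, l, hl, rfl⟩ := (mem_raysOfTokens e p).1 hp
      exact ⟨b, l, hl, rfl⟩
    · rintro ⟨b, l, hl, rfl⟩
      exact ⟨_, (mem_raysOfTokens e _).2 ⟨b, l, hl, rfl⟩, rfl⟩
  refine ⟨fun p hp => ?_, ?_⟩
  · obtain ⟨b, l, -, rfl⟩ := (hmem p).1 hp
    exact Nat.cast_nonneg _
  · have hbase := RegularExpression.isPumpBase e
    refine hbase.closure_convexHull_eq hr _ ?_ ?_ ?_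
    · intro w hw
      obtain ⟨l, hl, hs⟩ := Generates.exists_scanEffect (e := e) (x := w) (y := []) (μ := .word)
        ⟨hw, rfl⟩
      refine (hmem _).2 ⟨false, l, hl, ?_⟩
      rw [← realRay_of_base hr]
      exact congrArg _ (congrArg _ (by simpa using (hs [] [] [] true true).symm))
    · rintro ⟨x, z⟩ hp
      obtain ⟨u, v, hv, -⟩ := hbase.pump_mem _ hp
      obtain rfl : x = v ++ z := hv
      obtain ⟨l, hl, hs⟩ := Generates.exists_scanEffect (e := e) (μ := .pump) hp
      refine (hmem _).2 ⟨true, l, hl, ?_⟩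
      rw [← realRay_of_pump hr]
      exact congrArg _ (congrArg _ (by simpa using (hs [] [] [] true false).symm))
    · intro q hq
      obtain ⟨b, l, hl, rfl⟩ := (hmem q).1 hq
      obtain ⟨x, y, ok, hs, hg⟩ := exists_scanEffect e l hl (if b then .pump else .word)
      rw [hs]
      cases ok
      · exact Or.inl (realRay_scanRay_of_not_ok _ rfl)
      · have hg := hg rfl
        cases b
        · obtain ⟨hx, rfl⟩ := hg
          exact Or.inr (Or.inl ⟨x, hx, by simpa using realRay_of_base hr x⟩)
        · obtain ⟨u, v, hv, -⟩ := hbase.pump_mem _ hg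
          obtain rfl : x = v ++ y := hv
          exact Or.inr (Or.inr ⟨_, hg, by simpa using realRay_of_pump hr v y⟩)

end Rays

/-! ### Counting the steps of a machine. -/

open StateTransition Turing

section Steps

variable {σ : Type*} {f : σ → Option σ}

/-- `b` is reached from `a` in at most `t` steps. -/
def StepsTo (f : σ → Option σ) (t : ℕ) (a b : σ) : Prop :=
  Nonempty (EvalsToInTime f a (some b) t)

theorem StepsTo.single {a b : σ} (h : f a = some b) : StepsTo f 1 a b :=
  ⟨⟨⟨1, by simpa [flip] using h⟩, le_rfl⟩⟩

theorem StepsTo.trans {t₁ t₂ : ℕ} {a b c : σ} (h₁ : StepsTo f t₁ a b) (h₂ : StepsTo f t₂ b c) :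
    StepsTo f (t₂ + t₁) a c :=
  h₁.elim fun h₁ => h₂.elim fun h₂ => ⟨EvalsToInTime.trans f _ _ _ _ _ h₁ h₂⟩

theorem StepsTo.mono {t₁ t₂ : ℕ} {a b : σ} (h : StepsTo f t₁ a b) (ht : t₁ ≤ t₂) :
    StepsTo f t₂ a b :=
  h.elim fun h => ⟨⟨h.toEvalsTo, h.steps_le_m.trans ht⟩⟩

theorem StepsTo.congr_right {t : ℕ} {a b c : σ} (h : StepsTo f t a b) (hc : b = c) :
    StepsTo f t a c :=
  hc ▸ h

theorem StepsTo.congr_left {t : ℕ} {a b c : σ} (h : StepsTo f t a c) (hb : b = a) :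
    StepsTo f t b c :=
  hb ▸ h

theorem StepsTo.head {t : ℕ} {a b c : σ} (h₁ : f a = some b) (h₂ : StepsTo f t b c) :
    StepsTo f (t + 1) a c :=
  (StepsTo.single h₁).trans h₂

end Steps

section PushOption

variable {K : Type*} [DecidableEq K] {Γ : K → Type*} {Λ σ : Type*}

/-- Pushing a symbol that depends on the state, or nothing. -/
def pushOption (k : K) (d : Γ k) (f : σ → Option (Γ k)) (q : TM2.Stmt Γ Λ σ) : TM2.Stmt Γ Λ σ :=
  .branch (fun v => (f v).isSome) (.push k (fun v => (f v).getD d) q) q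

theorem stepAux_pushOption (k : K) (d : Γ k) (f : σ → Option (Γ k)) (q : TM2.Stmt Γ Λ σ) (v : σ)
    (S : ∀ k, List (Γ k)) : TM2.stepAux (pushOption k d f q) v S =
      TM2.stepAux q v (Function.update S k ((f v).toList ++ S k)) := by
  cases h : f v <;> simp [pushOption, h]

end PushOption

/-! ### The multi-stack machine. -/

section Machine

/-- The stacks of the machine. -/
inductive StackIdx : Type
  | input
  | todo
  | done
  | modes
  | fst
  | snd
  | diff
  | output
  deriving DecidableEq

instance : Fintype StackIdx :=
  ⟨{.input, .todo, .done, .modes, .fst, .snd, .diff, .output}, fun x => by cases x <;> simp⟩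

/-- A token with a choice; `none` starts the scan of an expression. -/
abbrev Cell (r m : ℕ) : Type := Option (RegexToken (DigitVector r m)) × Bool

/-- The symbols on the stacks. -/
abbrev StackSym (r m : ℕ) : StackIdx → Type
  | .input => RegexToken (DigitVector r m)
  | .todo => Cell r m
  | .done => Cell r m
  | .modes => ScanMode
  | .fst => DigitVector r m
  | .snd => DigitVector r m
  | .diff => DigitVector r m
  | .output => RayToken r

theorem finite_stackSym (r m : ℕ) (k : StackIdx) : Finite (StackSym r m k) := by
  cases k <;> unfold StackSym <;> infer_instance

/-- The labels of the machine. -/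
inductive Label (m : ℕ) : Type
  | load
  | scan
  | sub
  | emit (j : Fin m)
  | back (j : Fin m)
  | drop
  | inc
  | clear
  deriving DecidableEq, Fintype

/-- The registers of the machine. -/
@[ext] structure Regs (r m : ℕ) where
  tok : Option (RegexToken (DigitVector r m)) := none
  cell : Option (Cell r m) := none
  mode : ScanMode := .skip
  ok : Bool := true
  isWord : Bool := true
  borrow : Fin m → Bool := fun _ => false
  fst : Option (DigitVector r m) := none
  snd : Option (DigitVector r m) := none
  nonzero : Bool := false
  carry : Bool := false

instance (r m : ℕ) : Finite (Regs r m) :=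
  Finite.of_injective (fun v : Regs r m => (v.tok, v.cell, v.mode, v.ok, v.isWord, v.borrow,
    v.fst, v.snd, v.nonzero, v.carry)) fun v w h => by
      simp only [Prod.mk.injEq] at h
      ext1 <;> simp [h]

variable {r m : ℕ}

/-- The token and choice that were read. -/
def Regs.getCell (v : Regs r m) : Cell r m := v.cell.getD (none, false)

variable [NeZero r] [NeZero m]

/-- The program of the machine. -/
def rayProgram : Label m → TM2.Stmt (StackSym r m) (Label m) (Regs r m)
  | .load =>
    .pop .input (fun v t => { v with tok := t }) <|
    .branch (fun v => v.tok.isSome)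
      (.push .todo (fun v => (v.tok, false)) <|
        .goto fun _ => .load)
      (.push .todo (fun _ => (none, false)) <|
        .load (fun _ => {}) <|
        .goto fun _ => .scan)
  | .scan =>
    .pop .todo (fun v t => { v with cell := t }) <|
    .branch (fun v => v.cell.isSome)
      (.push .done (fun v => v.getCell) <|
        .pop .modes (fun v μ => { v with mode := μ.getD .skip }) <|
        pushOption .modes .skip (fun v => (pushedModes v.mode v.getCell)[1]?) <|
        pushOption .modes .skip (fun v => (pushedModes v.mode v.getCell)[0]?) <|
        pushOption .fst (fun _ => 0) (fun v => emitFst v.mode v.getCell) <|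
        pushOption .snd (fun _ => 0) (fun v => emitSnd v.mode v.getCell) <|
        .load (fun v => { v with
          ok := v.ok && tokenOk v.mode v.getCell
          isWord := nextIsWord v.isWord v.getCell }) <|
        .goto fun _ => .scan)
      (.load (fun v => { ok := v.ok, isWord := v.isWord }) <|
        .goto fun _ => .sub)
  | .sub =>
    .pop .fst (fun v a => { v with fst := a }) <|
    .pop .snd (fun v b => { v with snd := b }) <|
    .branch (fun v => v.fst.isSome)
      (pushOption .diff (fun _ => 0)
          (fun v => if v.ok then v.fst.map fun a => subDigit v.borrow a v.snd else none) <|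
        .load (fun v => { v with
          borrow := v.fst.elim v.borrow fun a => subBorrow v.borrow a v.snd }) <|
        .goto fun _ => .sub)
      (.push .output (fun _ => .stop_mark) <|
        pushOption .output .stop_mark
          (fun v => if v.ok && v.isWord then some (.digit (Fin.ofNat r 1)) else none) <|
        .push .output (fun _ => .stop_mark) <|
        .load (fun _ => {}) <|
        .goto fun _ => .emit ⟨m - 1, Nat.sub_one_lt (NeZero.ne m)⟩)
  | .emit j =>
    .pop .diff (fun v a => { v with fst := a }) <|
    .branch (fun v => v.fst.isSome)
      (pushOption .fst (fun _ => 0) (fun v => v.fst) <|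
        .load (fun v => { v with
          nonzero := v.nonzero || v.fst.elim false fun a => decide (a j ≠ 0) }) <|
        pushOption .output .stop_mark
          (fun v => if v.nonzero then v.fst.map fun a => .digit (a j) else none) <|
        .goto fun _ => .emit j)
      (.load (fun _ => {}) <|
        .goto fun _ => if j = 0 then .drop else .back j)
  | .back j =>
    .pop .fst (fun v a => { v with fst := a }) <|
    .branch (fun v => v.fst.isSome)
      (pushOption .diff (fun _ => 0) (fun v => v.fst) <|
        .goto fun _ => .back j)
      (.push .output (fun _ => .stop_mark) <|
        .load (fun _ => {}) <|
        .goto fun _ => .emit ⟨j - 1, by omega⟩)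
  | .drop =>
    .pop .fst (fun v a => { v with fst := a }) <|
    .branch (fun v => v.fst.isSome)
      (.goto fun _ => .drop)
      (.load (fun _ => { carry := true }) <|
        .goto fun _ => .inc)
  | .inc =>
    .pop .done (fun v t => { v with cell := t }) <|
    .branch (fun v => v.cell.isSome)
      (.push .todo (fun v => (v.getCell.1, xor v.getCell.2 v.carry)) <|
        .load (fun v => { v with carry := v.getCell.2 && v.carry }) <|
        .goto fun _ => .inc)
      (.branch (fun v => v.carry)
        (.load (fun _ => {}) <| .goto fun _ => .clear)
        (.load (fun _ => {}) <| .goto fun _ => .scan))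
  | .clear =>
    .pop .todo (fun v t => { v with cell := t }) <|
    .branch (fun v => v.cell.isSome)
      (.goto fun _ => .clear)
      (.load (fun _ => {}) <| .halt)

omit [NeZero r] [NeZero m]

/-- The contents of the stacks. -/
def mkStacks (i : List (RegexToken (DigitVector r m))) (a b : List (Cell r m))
    (μ : List ScanMode) (x y z : List (DigitVector r m)) (o : List (RayToken r)) :
    ∀ k, List (StackSym r m k)
  | .input => i
  | .todo => a
  | .done => b
  | .modes => μ
  | .fst => x
  | .snd => y
  | .diff => z
  | .output => o

section mkStacks

variable (i i' : List (RegexToken (DigitVector r m))) (a b a' : List (Cell r m))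
    (μ μ' : List ScanMode) (x y z x' : List (DigitVector r m)) (o o' : List (RayToken r))

@[simp] theorem mkStacks_input : mkStacks i a b μ x y z o .input = i := rfl
@[simp] theorem mkStacks_todo : mkStacks i a b μ x y z o .todo = a := rfl
@[simp] theorem mkStacks_done : mkStacks i a b μ x y z o .done = b := rfl
@[simp] theorem mkStacks_modes : mkStacks i a b μ x y z o .modes = μ := rfl
@[simp] theorem mkStacks_fst : mkStacks i a b μ x y z o .fst = x := rfl
@[simp] theorem mkStacks_snd : mkStacks i a b μ x y z o .snd = y := rfl
@[simp] theorem mkStacks_diff : mkStacks i a b μ x y z o .diff = z := rfl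
@[simp] theorem mkStacks_output : mkStacks i a b μ x y z o .output = o := rfl

@[simp] theorem update_input : Function.update (mkStacks i a b μ x y z o) .input i' =
    mkStacks i' a b μ x y z o := by
  funext k; cases k <;> simp [Function.update]
@[simp] theorem update_todo : Function.update (mkStacks i a b μ x y z o) .todo a' =
    mkStacks i a' b μ x y z o := by
  funext k; cases k <;> simp [Function.update]
@[simp] theorem update_done : Function.update (mkStacks i a b μ x y z o) .done a' =
    mkStacks i a a' μ x y z o := by
  funext k; cases k <;> simp [Function.update]
@[simp] theorem update_modes : Function.update (mkStacks i a b μ x y z o) .modes μ' =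
    mkStacks i a b μ' x y z o := by
  funext k; cases k <;> simp [Function.update]
@[simp] theorem update_fst : Function.update (mkStacks i a b μ x y z o) .fst x' =
    mkStacks i a b μ x' y z o := by
  funext k; cases k <;> simp [Function.update]
@[simp] theorem update_snd : Function.update (mkStacks i a b μ x y z o) .snd x' =
    mkStacks i a b μ x x' z o := by
  funext k; cases k <;> simp [Function.update]
@[simp] theorem update_diff : Function.update (mkStacks i a b μ x y z o) .diff x' =
    mkStacks i a b μ x y x' o := by
  funext k; cases k <;> simp [Function.update]
@[simp] theorem update_output : Function.update (mkStacks i a b μ x y z o) .output o' =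
    mkStacks i a b μ x y z o' := by
  funext k; cases k <;> simp [Function.update]

end mkStacks

end Machine

/-! ### The phases of one round and their running times. -/

section Phases

variable {r m : ℕ}

/-- At most two modes are ever pushed, so two optional pushes suffice, the second mode going first.
-/
theorem getElem?_pushedModes (μ : ScanMode) (t : Cell r m) (s : List ScanMode) :
    (pushedModes μ t)[0]?.toList ++ ((pushedModes μ t)[1]?.toList ++ s) = pushedModes μ t ++ s := by
  obtain ⟨h⟩ | ⟨ν, h⟩ | ⟨ν₁, ν₂, h⟩ : pushedModes μ t = [] ∨ (∃ ν, pushedModes μ t = [ν]) ∨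
      ∃ ν₁ ν₂, pushedModes μ t = [ν₁, ν₂] := by
    rcases t with ⟨_ | _ | _ | a | _ | _ | _, b⟩ <;> simp only [pushedModes] <;>
      (try split_ifs) <;> simp
  all_goals simp [h]

variable [NeZero r] [NeZero m]

/-- A running configuration of the machine. -/
def runCfg (l : Label m) (v : Regs r m) (i : List (RegexToken (DigitVector r m)))
    (a b : List (Cell r m)) (μ : List ScanMode) (x y z : List (DigitVector r m))
    (o : List (RayToken r)) : TM2.Cfg (StackSym r m) (Label m) (Regs r m) :=
  ⟨some l, v, mkStacks i a b μ x y z o⟩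

/-- The machine gets from one configuration to another in a bounded number of steps. -/
abbrev RunsTo (t : ℕ) (c c' : TM2.Cfg (StackSym r m) (Label m) (Regs r m)) : Prop :=
  StepsTo (TM2.step rayProgram) t c c'

/-- Moving the postfix word to another stack brings its root to the top, below the starting token.
All tags are `false`, that is, the counter is 0. -/
theorem runsTo_load (i : List (RegexToken (DigitVector r m))) (a : List (Cell r m))
    (v : Regs r m) :
    RunsTo (i.length + 1) (runCfg .load v i a [] [] [] [] [] [])
      (runCfg .scan {} [] ((none, false) :: ((i.map fun t => (some t, false)).reverse ++ a))
        [] [] [] [] [] []) := by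
  induction i generalizing a v with
  | nil => exact .single (by simp [runCfg, rayProgram])
  | cons t i ih =>
    refine .head ?_ ((ih ((some t, false) :: a) { v with tok := some t }).congr_right ?_)
    · simp [runCfg, rayProgram]
    · rw [List.map_cons, List.reverse_cons, List.append_assoc]
      rfl

theorem runsTo_scan (a c : List (Cell r m)) (s : ScanState (DigitVector r m))
    (o : List (RayToken r)) (v : Regs r m) (hok : v.ok = s.ok) (hw : v.isWord = s.isWord) :
    RunsTo (a.length + 1) (runCfg .scan v [] a c s.modes s.fst s.snd [] o)
      (runCfg .sub { ok := (scan s a).ok, isWord := (scan s a).isWord } [] [] (a.reverse ++ c)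
        (scan s a).modes (scan s a).fst (scan s a).snd [] o) := by
  induction a generalizing c s v with
  | nil => exact .single (by simp [runCfg, rayProgram, scan, hok, hw])
  | cons t a ih =>
    rw [scan_cons, List.reverse_cons, List.append_assoc, List.singleton_append]
    refine .head ?_ (ih (t :: c) (scanStep s t)
      { v with
        cell := some t
        mode := s.modes.head?.getD .skip
        ok := (scanStep s t).ok
        isWord := (scanStep s t).isWord } rfl rfl)
    simp [runCfg, rayProgram, stepAux_pushOption, Regs.getCell, scanStep, hok, hw,
      getElem?_pushedModes]

/-- The output is a stack, so the ray is written from its end: the last coordinate `c` with its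
mark, then the mark of the component `m - 1`. The loop ends with the first stack, which is why the
second must not be longer. -/
theorem runsTo_sub (c : List (Cell r m)) (x y z : List (DigitVector r m)) (o : List (RayToken r))
    (v : Regs r m) (hxy : y.length ≤ x.length) :
    RunsTo (x.length + 1) (runCfg .sub v [] [] c [] x y z o)
      (runCfg (.emit ⟨m - 1, Nat.sub_one_lt (NeZero.ne m)⟩) {} [] [] c [] [] []
        ((if v.ok then subDigits v.borrow x y else []).reverse ++ z)
        (.stop_mark :: ((if v.ok && v.isWord then [.digit (Fin.ofNat r 1)] else []) ++
          .stop_mark :: o))) := by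
  induction x generalizing y z v with
  | nil =>
    obtain rfl : y = [] := by simpa using hxy
    refine .single ?_
    cases h : v.ok <;> cases h' : v.isWord <;>
      simp [runCfg, rayProgram, stepAux_pushOption, subDigits, h, h']
  | cons a x ih =>
    have hxy' : y.tail.length ≤ x.length := by
      simp only [List.length_tail, List.length_cons] at *
      omega
    have h := ih y.tail ((if v.ok then [subDigit v.borrow a y.head?] else []) ++ z)
      { v with fst := some a, snd := y.head?, borrow := subBorrow v.borrow a y.head? } hxy'
    refine .head ?_ (h.congr_right ?_)
    · cases h' : v.ok <;> simp [runCfg, rayProgram, stepAux_pushOption, h']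
    · cases h' : v.ok <;> simp [subDigits]

/-- The difference lies on its stack most significant digit on top, as suppressing zeros requires.
It is saved on another stack for the remaining components. -/
theorem runsTo_emit (j : Fin m) (c : List (Cell r m)) (x z : List (DigitVector r m))
    (o : List (RayToken r)) (v : Regs r m) :
    RunsTo (z.length + 1) (runCfg (.emit j) v [] [] c [] x [] z o)
      (runCfg (if j = 0 then .drop else .back j) {} [] [] c [] (z.reverse ++ x) [] []
        (emitDigits j v.nonzero z ++ o)) := by
  induction z generalizing x o v with
  | nil => exact .single (by simp [runCfg, rayProgram, emitDigits])
  | cons a z ih =>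
    have h := ih (a :: x)
      ((if v.nonzero || decide (a j ≠ 0) then [.digit (a j)] else []) ++ o)
      { v with fst := some a, nonzero := v.nonzero || decide (a j ≠ 0) }
    refine .head ?_ (h.congr_right ?_)
    · cases h' : v.nonzero <;> by_cases h'' : a j = 0 <;>
        simp [runCfg, rayProgram, stepAux_pushOption, h', h'']
    · rw [emitDigits, List.reverse_cons, List.append_assoc, List.append_assoc]
      rfl

theorem runsTo_back (j : Fin m) (c : List (Cell r m)) (x z : List (DigitVector r m))
    (o : List (RayToken r)) (v : Regs r m) :
    RunsTo (x.length + 1) (runCfg (.back j) v [] [] c [] x [] z o)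
      (runCfg (.emit ⟨j - 1, by omega⟩) {} [] [] c [] [] [] (x.reverse ++ z)
        (.stop_mark :: o)) := by
  induction x generalizing z v with
  | nil => exact .single (by simp [runCfg, rayProgram])
  | cons a x ih =>
    have h := ih (a :: z) { v with fst := some a }
    refine .head ?_ (h.congr_right ?_)
    · simp [runCfg, rayProgram, stepAux_pushOption]
    · rw [List.reverse_cons, List.append_assoc]
      rfl

theorem runsTo_drop (c : List (Cell r m)) (x : List (DigitVector r m))
    (o : List (RayToken r)) (v : Regs r m) :
    RunsTo (x.length + 1) (runCfg .drop v [] [] c [] x [] [] o)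
      (runCfg .inc { carry := true } [] [] c [] [] [] [] o) := by
  induction x generalizing v with
  | nil => exact .single (by simp [runCfg, rayProgram])
  | cons a x ih => exact .head (by simp [runCfg, rayProgram]) (ih { v with fst := some a })

/-- In a round, the preceding scan leaves the least significant tag on top of `done`, so the carry
ripples in the right direction while the cells return to `todo` in scanning order. -/
theorem runsTo_inc (a c : List (Cell r m)) (o : List (RayToken r)) (v : Regs r m) :
    RunsTo (c.length + 1) (runCfg .inc v [] a c [] [] [] [] o)
      (runCfg (if carryOut v.carry c then .clear else .scan) {} []
        ((addCarry v.carry c).reverse ++ a) [] [] [] [] [] o) := by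
  induction c generalizing a v with
  | nil =>
    refine .single ?_
    cases h : v.carry <;> simp [runCfg, rayProgram, carryOut, addCarry, h]
  | cons t c ih =>
    have h := ih ((t.1, xor t.2 v.carry) :: a)
      { v with cell := some t, carry := t.2 && v.carry }
    refine .head ?_ (h.congr_right ?_)
    · simp [runCfg, rayProgram, Regs.getCell]
    · rw [addCarry, List.reverse_cons, List.append_assoc]
      rfl

/-- A final configuration must have initial registers and no stack contents besides the output. -/
theorem runsTo_clear (a : List (Cell r m)) (o : List (RayToken r)) (v : Regs r m) :
    RunsTo (a.length + 1) (runCfg .clear v [] a [] [] [] [] [] o)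
      ⟨none, {}, mkStacks [] [] [] [] [] [] [] o⟩ := by
  induction a generalizing v with
  | nil => exact .single (by simp [runCfg, rayProgram])
  | cons t a ih => exact .head (by simp [runCfg, rayProgram]) (ih { v with cell := some t })

/-- Writing the components up to the `j`-th one of a vector. -/
theorem runsTo_components (hr : 2 ≤ r) (n : ℕ) (hn : n < m) (c : List (Cell r m))
    (w : List (DigitVector r m)) (o : List (RayToken r)) :
    RunsTo ((n + 1) * (2 * w.length + 2))
      (runCfg (.emit ⟨n, hn⟩) {} [] [] c [] [] [] w.reverse (.stop_mark :: o))
      (runCfg .inc { carry := true } [] [] c [] [] [] []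
        (((List.finRange m).take (n + 1)).flatMap (fun j => encodeInt hr (rho w j : ℤ)) ++ o)) := by
  induction n generalizing o with
  | zero =>
    have h1 := runsTo_emit ⟨0, hn⟩ c [] w.reverse (.stop_mark :: o) ({} : Regs r m)
    have h2 := runsTo_drop c (w.reverse.reverse ++ [])
      (emitDigits ⟨0, hn⟩ false w.reverse ++ .stop_mark :: o) ({} : Regs r m)
    have h3 : (List.finRange m).take 1 = [⟨0, hn⟩] := by
      rw [List.take_one]
      simp [List.head?_eq_getElem?, hn]
    rw [if_pos (Fin.ext (Fin.val_zero m).symm)] at h1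
    refine ((h1.trans h2).mono ?_).congr_right ?_
    · simp
      omega
    · rw [h3, List.flatMap_singleton, encodeInt_natCast, emitDigits_reverse hr, List.append_assoc]
      rfl
  | succ n ih =>
    have h1 := runsTo_emit ⟨n + 1, hn⟩ c [] w.reverse (.stop_mark :: o) ({} : Regs r m)
    have h2 := runsTo_back ⟨n + 1, hn⟩ c (w.reverse.reverse ++ []) []
      (emitDigits ⟨n + 1, hn⟩ false w.reverse ++ .stop_mark :: o) ({} : Regs r m)
    have h3 := ih (by omega) (encodeInt hr (rho w ⟨n + 1, hn⟩ : ℤ) ++ o)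
    have h4 : (List.finRange m).take (n + 1 + 1) =
        (List.finRange m).take (n + 1) ++ [⟨n + 1, hn⟩] := by
      rw [List.take_succ_eq_append_getElem (by simpa using hn)]
      simp
    rw [if_neg (by simp [Fin.ext_iff])] at h1
    have h5 := h1.trans h2
    simp only [List.reverse_reverse, List.append_nil] at h5
    rw [emitDigits_reverse hr] at h5
    rw [encodeInt_natCast, List.append_assoc] at h3
    refine ((h5.trans h3).mono ?_).congr_right ?_
    · simp only [List.length_reverse]
      nlinarith
    · rw [h4, List.flatMap_append, List.flatMap_singleton, encodeInt_natCast, List.append_assoc,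
        List.append_assoc]

end Phases

/-! ### The loop over all choices and the exponential time bound. -/

section Loop

variable {r m : ℕ}

theorem encodeInt_toNat [NeZero r] (hr : 2 ≤ r) (b : Bool) :
    encodeInt hr (b.toNat : ℤ) =
      (if b then [.digit (Fin.ofNat r 1)] else []) ++ [.stop_mark] := by
  rw [encodeInt_natCast]
  have h1 : ((Fin.ofNat r 1 : Fin r) : ℕ) = 1 := Nat.mod_eq_of_lt (by omega)
  have h := encodeDigits_add hr (Fin.ofNat r 1) 0 (by rw [h1]; simp)
  rw [h1, mul_zero, add_zero, encodeDigits_zero] at h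
  cases b
  · simp [encodeDigits_zero]
  · simp [h]

theorem encodeRays_cons (hr : 2 ≤ r) (p : IntRay m) (l : List (IntRay m)) :
    encodeRays hr (p :: l) =
      (List.finRange m).flatMap (fun j => encodeInt hr (p.1 j)) ++
        (encodeInt hr p.2 ++ encodeRays hr l) := by
  rw [← List.append_assoc, List.flatMap_def, ← List.ofFn_eq_map]
  rfl

variable [NeZero r] [NeZero m]

theorem runsTo_next (hr : 2 ≤ r) (e : RegularExpression (DigitVector r m)) {N : ℕ}
    (hN : N = (encodeRegex e).length + 1) {k : ℕ} (hk : k < 2 ^ N) (acc : List (IntRay m)) :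
    RunsTo ((N + 1) * (2 * m + 3))
      (runCfg .scan {} [] (tagBits ((encodeRegex e).map some ++ [none]) k).reverse [] [] [] [] []
        (encodeRays hr acc))
      (runCfg (if k + 1 = 2 ^ N then .clear else .scan) {} []
        (tagBits ((encodeRegex e).map some ++ [none]) (k + 1)).reverse [] [] [] [] []
        (encodeRays hr (choiceRay (encodeRegex e) k :: acc))) := by
  have hlen : ((encodeRegex e).map some ++ [none]).length = N := by simp [hN]
  have hcarry := carryOut_tagBits true ((encodeRegex e).map some ++ [none]) (hlen.symm ▸ hk)
  rw [hlen] at hcarry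
  -- The next round needs an empty mode stack again.
  have hmodes : (scan (startState _)
      (tagBits ((encodeRegex e).map some ++ [none]) k).reverse).modes = [] := by
    obtain ⟨b, l, h, hl⟩ := exists_reverse_tagBits e k
    obtain ⟨x, y, ok, hs, -⟩ := exists_scanEffect e l hl (if b then .pump else .word)
    rw [h, scan_startState, hs]
  have hfst := scan_fst_length_le (tagBits ((encodeRegex e).map some ++ [none]) k).reverse
    (startState _)
  have hsnd := scan_snd_length_le (tagBits ((encodeRegex e).map some ++ [none]) k).reverse
    (startState _) le_rfl
  have h1 := runsTo_scan (tagBits ((encodeRegex e).map some ++ [none]) k).reverse []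
    (startState _) (encodeRays hr acc) ({} : Regs r m) rfl rfl
  rw [hmodes, List.reverse_reverse, List.append_nil] at h1
  have hray : choiceRay (encodeRegex e) k = scanRay (scan (startState _)
    (tagBits ((encodeRegex e).map some ++ [none]) k).reverse) := rfl
  rw [List.length_reverse, length_tagBits, hlen] at h1 hfst
  rw [hray]
  generalize scan (startState _) (tagBits ((encodeRegex e).map some ++ [none]) k).reverse = s
    at h1 hfst hsnd ⊢
  have h2 := runsTo_sub (tagBits ((encodeRegex e).map some ++ [none]) k) s.fst s.snd []
    (encodeRays hr acc) ({ ok := s.ok, isWord := s.isWord } : Regs r m) hsnd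
  have h3 := runsTo_components hr (m - 1) (Nat.sub_one_lt (NeZero.ne m))
    (tagBits ((encodeRegex e).map some ++ [none]) k) (rayDigits s)
    ((if s.ok && s.isWord then [.digit (Fin.ofNat r 1)] else []) ++
      .stop_mark :: encodeRays hr acc)
  have h4 := runsTo_inc [] (tagBits ((encodeRegex e).map some ++ [none]) k)
    (encodeRays hr (scanRay s :: acc)) ({ carry := true } : Regs r m)
  rw [hcarry, addCarry_tagBits, length_tagBits, hlen, List.append_nil] at h4
  have hm : m - 1 + 1 = m := Nat.sub_one_add_one (NeZero.ne m)
  rw [hm, List.take_of_length_le (by simp)] at h3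
  have hdigits : (rayDigits s).length ≤ N := by
    simp only [startState, List.length_nil, zero_add] at hfst
    unfold rayDigits
    split
    · rwa [length_subDigits]
    · simp
  rw [List.append_nil] at h2
  -- Scanning, subtracting and incrementing cost at most `N + 1` steps each; each of the `m`
  -- components costs at most `2 * (N + 1)`.
  refine (((h1.trans h2).trans (h3.congr_right ?_)).trans (h4.congr_right ?_)).mono ?_
  · rw [encodeRays_cons]
    simp only [scanRay, encodeInt_toNat, List.append_assoc, List.singleton_append]
  · simp only [Bool.toNat_true, decide_eq_true_eq]
  · simp only [startState, List.length_nil, zero_add] at hfst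
    have : m * (2 * (rayDigits s).length + 2) ≤ m * (2 * N + 2) := by gcongr
    nlinarith

theorem runsTo_loop (hr : 2 ≤ r) (e : RegularExpression (DigitVector r m)) {N : ℕ}
    (hN : N = (encodeRegex e).length + 1) (d : ℕ) {k : ℕ} (hk : k + d + 1 = 2 ^ N)
    (acc : List (IntRay m)) :
    RunsTo ((d + 1) * ((N + 1) * (2 * m + 3)))
      (runCfg .scan {} [] (tagBits ((encodeRegex e).map some ++ [none]) k).reverse [] [] [] [] []
        (encodeRays hr acc))
      (runCfg .clear {} []
        (tagBits ((encodeRegex e).map some ++ [none]) (2 ^ N)).reverse [] [] [] [] []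
        (encodeRays hr
          (((List.range' k (d + 1)).map (choiceRay (encodeRegex e))).reverse ++ acc))) := by
  induction d generalizing k acc with
  | zero =>
    have h := runsTo_next hr e hN (k := k) (by omega) acc
    rw [if_pos (by omega), show k + 1 = 2 ^ N by omega] at h
    simpa using h
  | succ d ih =>
    have h := runsTo_next hr e hN (k := k) (by omega) acc
    rw [if_neg (by omega)] at h
    refine ((h.trans (ih (k := k + 1) (by omega) _)).mono (by linarith)).congr_right ?_
    rw [show List.range' k (d + 1 + 1) = k :: List.range' (k + 1) (d + 1) from List.range'_succ,
      List.map_cons, List.reverse_cons, List.append_assoc]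
    rfl

theorem runsTo_rays (hr : 2 ≤ r) (e : RegularExpression (DigitVector r m)) {n : ℕ}
    (hn : (encodeRegex e).length = n) :
    RunsTo (2 ^ (n + 1) * ((n + 2) * (2 * m + 3)) + 2 * (n + 2))
      (runCfg .load {} (encodeRegex e) [] [] [] [] [] [] [])
      ⟨none, {}, mkStacks [] [] [] [] [] [] [] (encodeRays hr (raysOfTokens (encodeRegex e)))⟩ := by
  have h1 := runsTo_load (encodeRegex e) [] ({} : Regs r m)
  have hpos : 0 < 2 ^ (n + 1) := by positivity
  -- The starting token carries a choice of its own, whence `n + 1` bits.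
  have h2 := runsTo_loop hr e (N := n + 1) (by rw [hn]) (2 ^ (n + 1) - 1) (k := 0) (by omega) []
  have h3 := runsTo_clear (tagBits ((encodeRegex e).map some ++ [none]) (2 ^ (n + 1))).reverse
    (encodeRays hr (raysOfTokens (encodeRegex e))) ({} : Regs r m)
  rw [tagBits_zero, List.map_append, List.reverse_append, List.map_map] at h2
  rw [List.append_nil] at h1
  refine (((h1.congr_right ?_).trans h2).trans (h3.congr_left ?_)).mono ?_
  · rfl
  · rw [Nat.sub_add_cancel hpos, ← List.range_eq_range', List.append_nil, raysOfTokens, hn]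
  · rw [Nat.sub_add_cancel hpos, List.length_reverse, length_tagBits, List.length_append,
      List.length_map, hn, List.length_singleton, Nat.add_assoc n 1 1]
    omega

/-- The machine computing the rays of a regular expression. -/
noncomputable def rayMachine (r m : ℕ) [NeZero r] [NeZero m] : FinTM2 where
  K := StackIdx
  k₀ := .input
  k₁ := .output
  Γ := StackSym r m
  Λ := Label m
  main := .load
  σ := Regs r m
  initialState := {}
  σFin := Fintype.ofFinite _
  Γk₀Fin := Fintype.ofFinite _
  m := rayProgram

theorem initList_rayMachine (l : List (RegexToken (DigitVector r m))) :
    initList (rayMachine r m) l = runCfg .load {} l [] [] [] [] [] [] [] := by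
  refine TM2.Cfg.mk.injEq _ _ _ _ _ _ ▸ ⟨rfl, rfl, ?_⟩
  funext k
  cases k <;> rfl

theorem haltList_rayMachine (l : List (RayToken r)) :
    haltList (rayMachine r m) l = ⟨none, {}, mkStacks [] [] [] [] [] [] [] l⟩ := by
  refine TM2.Cfg.mk.injEq _ _ _ _ _ _ ▸ ⟨rfl, rfl, ?_⟩
  funext k
  cases k <;> rfl

theorem time_le (m n : ℕ) :
    2 ^ (n + 1) * ((n + 2) * (2 * m + 3)) + 2 * (n + 2) ≤ 2 ^ (2 * n + (2 * m + 6)) := by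
  have h1 : n + 2 ≤ 2 ^ (n + 1) := Nat.lt_two_pow_self
  have h2 : 2 * m + 3 ≤ 2 ^ (2 * m + 3) := Nat.lt_two_pow_self.le
  calc 2 ^ (n + 1) * ((n + 2) * (2 * m + 3)) + 2 * (n + 2)
      ≤ 2 ^ (n + 1) * (2 ^ (n + 1) * 2 ^ (2 * m + 3)) + 2 * 2 ^ (n + 1) := by gcongr
    _ = 2 ^ (2 * n + 2 * m + 5) + 2 ^ (n + 2) := by ring
    _ ≤ 2 ^ (2 * n + 2 * m + 5) + 2 ^ (2 * n + 2 * m + 5) := by gcongr <;> omega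
    _ = 2 ^ (2 * n + (2 * m + 6)) := by ring

theorem computableInExpTime_raysOfTokens (hr : 2 ≤ r) :
    ComputableInExpTime (encodeRegex (A := DigitVector r m)) (encodeRays hr)
      fun e => raysOfTokens (encodeRegex e) := by
  refine ⟨{
    tm := rayMachine r m
    inputAlphabet := Equiv.refl _
    outputAlphabet := Equiv.refl _
    time := fun n => 2 ^ (n + 1) * ((n + 2) * (2 * m + 3)) + 2 * (n + 2)
    outputsFun := fun e => Classical.choice ?_ }, fun k => ?_,
    2 * Polynomial.X + Polynomial.C (2 * m + 6), fun n => ?_⟩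
  · have h := runsTo_rays hr e rfl
    exact (h.congr_left ((congrArg (initList (rayMachine r m))
      (List.map_id (encodeRegex e))).trans (initList_rayMachine _))).congr_right
      ((congrArg (haltList (rayMachine r m)) (List.map_id _)).trans (haltList_rayMachine _)).symm
  · exact finite_stackSym r m k
  · simpa using time_le m n

end Loop

theorem mainTheorem1 (r m : ℕ) (hr : 2 ≤ r) (hm : 1 ≤ m) :
    (∀ L : Language (DigitVector r m), L.IsRegular →
      IsPolyhedralConvex (closure (convexHull ℝ (representedSet L)))) ∧
    ∃ rays : RegularExpression (DigitVector r m) → List (IntRay m),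
      (∀ e : RegularExpression (DigitVector r m),
        IsRepresentedByRays (closure (convexHull ℝ (representedSet e.matches')))
          (realRays (rays e))) ∧
      ComputableInExpTime encodeRegex (encodeRays hr) rays := by
  have : NeZero r := ⟨by omega⟩
  have : NeZero m := ⟨by omega⟩
  exact ⟨fun L hL => isPolyhedralConvex_of_isRegular hr hL,
    fun e => raysOfTokens (encodeRegex e), isRepresentedByRays_raysOfTokens hr,
    computableInExpTime_raysOfTokens hr⟩
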